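/- Let $\mathfrak g$ be a finite-dimensional complex semisimple Lie algebra, $\mathfrak h\subset\mathfrak g$ a Cartan subalgebra, $\{\alpha_1,\dots,\alpha_n\}$ a base of simple roots, and $D$ a subset of the simple roots (a subdiagram of the Dynkin diagram). Let $\mathfrak g_D$ be the subalgebra generated by the root vectors for $\pm\alpha_i$, $\alpha_i\in D$, let $\mathfrak l_D=\mathfrak g_D+\mathfrak h$, and let $\mathfrak c_D$ be the centre of $\mathfrak l_D$. Let $\mathfrak n_D^+$ be the sum of the root spaces $\mathfrak g_\alpha$ over the positive roots $\alpha$ that are not roots of $\mathfrak g_D$. For $k\ge 0$ (with $U^{\otimes 0}=\mathbb C$) let $(U\mathfrak g^{\otimes k})^{\mathfrak c_D}$ be the invariants of the diagonal adjoint action of $\mathfrak c_D$ and put $$I_k=(U\mathfrak g^{\otimes k})^{\mathfrak c_D}\cap\sum_{j=1}^k U\mathfrak g^{\otimes k}\cdot(\mathfrak n_D^+)_j,\qquad y_j=1^{\otimes(j-1)}\otimes y\otimes 1^{\otimes(k-j)}.$$ Every $x\in(U\mathfrak g^{\otimes k})^{\mathfrak c_D}$ is congruent modulo $I_k$ to (the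 image of) a unique element $\pi_D^k(x)\in U\mathfrak l_D^{\otimes k}$, and there is a unique Lie algebra homomorphism $\pi:\mathfrak l_D\to\mathfrak g_D$ that is the identity on $\mathfrak g_D$ and zero on $\mathfrak c_D$. Let $\overline\pi_D^k=(U\pi)^{\otimes k}\circ\pi_D^k:(U\mathfrak g^{\otimes k})^{\mathfrak c_D}\to U\mathfrak g_D^{\otimes k}$. Let $\Delta$ denote the coproduct of an enveloping algebra, $\Delta(a)=a\otimes 1+1\otimes a$ for $a$ in the Lie algebra. Then: 1. For all $k$, all $0\le i\le k-1$ and all $x\in(U\mathfrak g^{\otimes k})^{\mathfrak c_D}$, the element $(\mathrm{id}^{\otimes i}\otimes\Delta\otimes\mathrm{id}^{\otimes(k-i-1)})(x)$ is $\mathfrak c_D$-invariant and $$(\mathrm{id}^{\otimes i}\otimes\Delta\otimes\mathrm{id}^{\otimes(k-i-1)})(\pi_D^k(x))=\pi_D^{k+1}\bigl((\mathrm{id}^{\otimes i}\otimes\Delta\otimes\mathrm{id}^{\otimes(k-i-1)})(x)\bigr).$$ 2. For all $i,l\ge 0$ with $i+l\le k$ and all $y\in(U\mathfrak g^{\otimes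 l})^{\mathfrak c_D}$, the element $1^{\otimes i}\otimes y\otimes 1^{\otimes(k-i-l)}$ is $\mathfrak c_D$-invariant and $$1^{\otimes i}\otimes\pi_D^l(y)\otimes 1^{\otimes(k-i-l)}=\pi_D^k\bigl(1^{\otimes i}\otimes y\otimes 1^{\otimes(k-i-l)}\bigr).$$ 3. Let $d_H x=1\otimes x+\sum_{i=1}^k(-1)^i(\mathrm{id}^{\otimes(i-1)}\otimes\Delta\otimes\mathrm{id}^{\otimes(k-i)})(x)+(-1)^{k+1}x\otimes 1$ be the Hochschild differential from $k$-fold to $(k+1)$-fold tensor powers of an enveloping algebra. For all $x\in(U\mathfrak g^{\otimes k})^{\mathfrak c_D}$, the element $d_Hx$ is $\mathfrak c_D$-invariant and $d_H(\pi_D^k(x))=\pi_D^{k+1}(d_Hx)$. The identities in 1, 2 and 3 also hold with $\pi_D^k,\pi_D^{k+1},\pi_D^l$ replaced throughout by $\overline\pi_D^k,\overline\pi_D^{k+1},\overline\pi_D^l$. -/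

import Mathlib

open scoped TensorProduct

noncomputable section

namespace HC

/-! ### Tensor powers of an algebra: insertions and faces -/

section TensorPowers

variable {A : Type*} [Ring A] [Algebra ℂ A]

/-- The `k`-fold tensor power `A ⊗ ⋯ ⊗ A` over `ℂ`, an associative algebra. -/
abbrev TPow (k : ℕ) (A : Type*) [Ring A] [Algebra ℂ A] : Type _ := ⨂[ℂ] _ : Fin k, A

/-- `slot j a = 1 ⊗ ⋯ ⊗ a ⊗ ⋯ ⊗ 1`, with `a` in the slot `j` (slots are numbered from `0`). -/
abbrev slot {k : ℕ} (j : Fin k) : A →ₐ[ℂ] TPow k A :=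
  PiTensorProduct.singleAlgHom (R := ℂ) (A := fun _ : Fin k => A) j

/-- The linear map `x₀ ⊗ ⋯ ⊗ x_{k-1} ↦ φ₀(x₀) φ₁(x₁) ⋯ φ_{k-1}(x_{k-1})`. -/
def ordProd {B : Type*} [Ring B] [Algebra ℂ B] {k : ℕ} (φ : Fin k → A →ₐ[ℂ] B) :
    TPow k A →ₗ[ℂ] B :=
  PiTensorProduct.lift
    ((MultilinearMap.mkPiAlgebraFin ℂ k B).compLinearMap fun j => (φ j).toLinearMap)

/-- The insertion `y ↦ 1^{⊗ i} ⊗ y ⊗ 1^{⊗ (k - l - i)}` from `A^{⊗ l}` to `A^{⊗ k}`. -/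
def insertOnes {l k : ℕ} (i : ℕ) (h : i + l ≤ k) : TPow l A →ₗ[ℂ] TPow k A :=
  ordProd fun m : Fin l => slot ⟨i + m, by omega⟩

/-- The map `a ⊗ b ↦ 1^{⊗ i} ⊗ a ⊗ b ⊗ 1^{⊗ (k - i - 1)}` from `A ⊗ A` to `A^{⊗ (k + 1)}`. -/
def slotPair {k : ℕ} (i : Fin k) : A ⊗[ℂ] A →ₐ[ℂ] TPow (k + 1) A :=
  Algebra.TensorProduct.lift (slot i.castSucc) (slot i.succ) fun a b => by
    simp only [Commute, SemiconjBy, PiTensorProduct.singleAlgHom_apply,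
      PiTensorProduct.tprod_mul_tprod]
    have hne : i.castSucc ≠ i.succ := (Fin.castSucc_lt_succ).ne
    exact congrArg _ (Pi.mulSingle_commute (f := fun _ : Fin (k + 1) => A) hne a b).eq

/-- The face map `id^{⊗ i} ⊗ Δ ⊗ id^{⊗ (k - i - 1)}` from `A^{⊗ k}` to `A^{⊗ (k + 1)}`: the slots
`j < i` stay in place, `Δ` sends the slot `i` to the slots `i, i + 1`, and the slots `j > i`
are shifted to `j + 1`. -/
def faceMap (Δ : A →ₐ[ℂ] A ⊗[ℂ] A) {k : ℕ} (i : Fin k) : TPow k A →ₗ[ℂ] TPow (k + 1) A :=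
  ordProd fun j : Fin k =>
    if j < i then slot j.castSucc else if i < j then slot j.succ else (slotPair i).comp Δ

/-- The Hochschild differential
`d x = 1 ⊗ x + ∑_{i=1}^{k} (-1)^i (id^{⊗ (i-1)} ⊗ Δ ⊗ id^{⊗ (k-i)})(x) + (-1)^{k+1} x ⊗ 1`. -/
def hochschild (Δ : A →ₐ[ℂ] A ⊗[ℂ] A) (k : ℕ) : TPow k A →ₗ[ℂ] TPow (k + 1) A :=
  insertOnes 1 (by omega)
    + ∑ i : Fin k, (-1 : ℂ) ^ ((i : ℕ) + 1) • faceMap Δ i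
    + (-1 : ℂ) ^ (k + 1) • insertOnes 0 (by omega)

/-- The map `φ^{⊗ k} : A^{⊗ k} → B^{⊗ k}`. -/
def tpowMap {B : Type*} [Ring B] [Algebra ℂ B] (k : ℕ) (φ : A →ₐ[ℂ] B) :
    TPow k A →ₗ[ℂ] TPow k B :=
  PiTensorProduct.map fun _ => φ.toLinearMap

theorem prod_ofFn_eq_single {M : Type*} [Monoid M] :
    ∀ {k : ℕ} (F : Fin k → M) (j : Fin k), (∀ m, m ≠ j → F m = 1) → (List.ofFn F).prod = F j
  | 0, _, j, _ => j.elim0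
  | k + 1, F, j, h => by
    rw [List.ofFn_succ, List.prod_cons]
    induction j using Fin.cases with
    | zero =>
      have : (fun i : Fin k => F i.succ) = fun _ => 1 := by
        funext m; exact h _ (Fin.succ_ne_zero m)
      rw [this]; simp
    | succ j =>
      rw [h 0 (Fin.succ_ne_zero j).symm, one_mul]
      exact prod_ofFn_eq_single (fun i => F i.succ) j
        fun m hm => h _ fun e => hm (Fin.succ_injective _ e)

theorem prod_ofFn_tprod {k n : ℕ} (F : Fin k → Fin n → A) :
    (List.ofFn fun j => PiTensorProduct.tprod ℂ (F j)).prod =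
      PiTensorProduct.tprod ℂ fun m => (List.ofFn fun j => F j m).prod := by
  induction k with
  | zero => simp; rfl
  | succ k ih =>
    rw [List.ofFn_succ, List.prod_cons, ih, PiTensorProduct.tprod_mul_tprod]
    congr 1
    funext m
    simp [List.ofFn_succ]

/-- On pure tensors, `insertOnes` does what its description says. -/
theorem insertOnes_tprod {l k : ℕ} (i : ℕ) (h : i + l ≤ k) (x : Fin l → A) :
    insertOnes i h (PiTensorProduct.tprod ℂ x) =
      PiTensorProduct.tprod ℂ fun m : Fin k =>
        if hm : i ≤ m ∧ (m : ℕ) < i + l then x ⟨m - i, by omega⟩ else 1 := by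
  simp only [insertOnes, ordProd, PiTensorProduct.lift.tprod, MultilinearMap.compLinearMap_apply,
    MultilinearMap.mkPiAlgebraFin_apply, AlgHom.toLinearMap_apply,
    PiTensorProduct.singleAlgHom_apply]
  rw [prod_ofFn_tprod]
  congr 1
  funext m
  simp only [MonoidHom.mulSingle_apply]
  split_ifs with hm
  · rw [prod_ofFn_eq_single _ ⟨m - i, by omega⟩]
    · have : m = ⟨i + (m - i), by omega⟩ := by ext; simp; omega
      rw [Pi.mulSingle_apply, if_pos this]
    · intro j hj
      rw [Pi.mulSingle_apply, if_neg]
      rintro rfl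
      exact hj (by ext; simp)
  · apply List.prod_eq_one
    intro a ha
    obtain ⟨j, rfl⟩ := (List.mem_ofFn' _ _).1 ha
    beta_reduce
    rw [Pi.mulSingle_apply, if_neg]
    rintro rfl
    exact hm ⟨by simp, by simp⟩

/-- On pure tensors, if `Δ(x_i) = ∑ y_t ⊗ z_t` then `faceMap Δ i` maps `x_0 ⊗ ⋯ ⊗ x_{k-1}` to
`∑ x_0 ⊗ ⋯ ⊗ x_{i-1} ⊗ y_t ⊗ z_t ⊗ x_{i+1} ⊗ ⋯ ⊗ x_{k-1}`. -/
theorem faceMap_tprod (Δ : A →ₐ[ℂ] A ⊗[ℂ] A) {k : ℕ} (i : Fin k) (x : Fin k → A)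
    {T : Type*} (s : Finset T) (y z : T → A) (hΔ : Δ (x i) = ∑ t ∈ s, y t ⊗ₜ[ℂ] z t) :
    faceMap Δ i (PiTensorProduct.tprod ℂ x) =
      ∑ t ∈ s, PiTensorProduct.tprod ℂ
        (Fin.insertNth (α := fun _ => A) i.castSucc (y t) (Function.update x i (z t))) := by
  let m : Fin k → TPow (k + 1) A := fun j =>
    if j < i then slot j.castSucc (x j) else if i < j then slot j.succ (x j) else 1
  have h1 : faceMap Δ i (PiTensorProduct.tprod ℂ x) =
      MultilinearMap.mkPiAlgebraFin ℂ k (TPow (k + 1) A)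
        (Function.update m i (slotPair i (Δ (x i)))) := by
    simp only [faceMap, ordProd, PiTensorProduct.lift.tprod, MultilinearMap.compLinearMap_apply]
    congr 1
    funext j
    rcases lt_trichotomy j i with h | rfl | h
    · simp [m, h, h.ne]
    · simp
    · simp [m, h, h.ne', h.not_gt]
  rw [h1, hΔ, map_sum, MultilinearMap.map_update_sum]
  refine Finset.sum_congr rfl fun t _ => ?_
  let F : Fin k → Fin (k + 1) → A := fun j =>
    if j < i then Pi.mulSingle j.castSucc (x j) else if i < j then Pi.mulSingle j.succ (x j)
    else Pi.mulSingle i.castSucc (y t) * Pi.mulSingle i.succ (z t)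
  have h2 : Function.update m i (slotPair i (y t ⊗ₜ[ℂ] z t)) =
      fun j => PiTensorProduct.tprod ℂ (F j) := by
    funext j
    rcases lt_trichotomy j i with h | rfl | h
    · simp [m, F, h, h.ne, MonoidHom.mulSingle_apply]
    · simp [F, slotPair, MonoidHom.mulSingle_apply, PiTensorProduct.tprod_mul_tprod]
    · simp [m, F, h, h.ne', h.not_gt, MonoidHom.mulSingle_apply]
  rw [h2, MultilinearMap.mkPiAlgebraFin_apply, prod_ofFn_tprod]
  congr 1
  funext n
  have hF : ∀ (j : Fin k) (n : Fin (k + 1)), F j n =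
      if j < i then (if n = j.castSucc then x j else 1)
      else if i < j then (if n = j.succ then x j else 1)
      else (if n = i.castSucc then y t else 1) * (if n = i.succ then z t else 1) := by
    intro j n
    simp only [F]
    split_ifs <;> simp_all
  induction n using Fin.succAboveCases i.castSucc with
  | x =>
    rw [Fin.insertNth_apply_same, prod_ofFn_eq_single _ i]
    · rw [hF]; simp [Fin.ext_iff]
    · intro j hj
      rw [hF]
      simp only [Fin.ext_iff, Fin.lt_def, Fin.val_castSucc, Fin.val_succ, ne_eq] at *
      split_ifs <;> first | rfl | omega
  | p j =>
    rw [Fin.insertNth_apply_succAbove, prod_ofFn_eq_single _ j]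
    · rw [hF]
      rcases lt_trichotomy j i with h | rfl | h
      · have h' : j.castSucc < i.castSucc := h
        simp [h, h.ne, Fin.succAbove_of_castSucc_lt _ _ h']
      · simp [Fin.succAbove_of_le_castSucc, Fin.ext_iff]
      · have h' : i.castSucc ≤ j.castSucc := h.le
        simp [h, h.ne', h.not_gt, Fin.succAbove_of_le_castSucc _ _ h']
    · intro q hq
      rw [hF]
      simp only [Fin.succAbove, Fin.ext_iff, Fin.lt_def, Fin.val_castSucc, ne_eq] at *
      split_ifs <;> simp_all <;> omega

end TensorPowers

/-! ### The universal enveloping algebra as a functor, and its coproduct -/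

section Enveloping

attribute [local instance 100] LieRing.ofAssociativeRing

variable {L L' : Type*} [LieRing L] [LieAlgebra ℂ L] [LieRing L'] [LieAlgebra ℂ L']

/-- The universal enveloping algebra of a complex Lie algebra. -/
abbrev U (L : Type*) [LieRing L] [LieAlgebra ℂ L] : Type _ := UniversalEnvelopingAlgebra ℂ L

/-- The algebra homomorphism `U L → U L'` induced by a Lie algebra homomorphism `L → L'`. -/
def uMap (f : L →ₗ⁅ℂ⁆ L') : U L →ₐ[ℂ] U L' :=
  UniversalEnvelopingAlgebra.lift ℂ ((UniversalEnvelopingAlgebra.ι ℂ).comp f)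

/-- The Lie algebra homomorphism `a ↦ a ⊗ 1 + 1 ⊗ a`. -/
def comulLie (L : Type*) [LieRing L] [LieAlgebra ℂ L] : L →ₗ⁅ℂ⁆ U L ⊗[ℂ] U L where
  toFun a := UniversalEnvelopingAlgebra.ι ℂ a ⊗ₜ 1 + 1 ⊗ₜ UniversalEnvelopingAlgebra.ι ℂ a
  map_add' a b := by simp only [map_add, TensorProduct.add_tmul, TensorProduct.tmul_add]; abel
  map_smul' c a := by simp [TensorProduct.smul_tmul', smul_add]
  map_lie' {a b} := by
    simp only [LieHom.map_lie, LieRing.of_associative_ring_bracket, add_mul, mul_add,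
      Algebra.TensorProduct.tmul_mul_tmul, one_mul, mul_one, TensorProduct.sub_tmul,
      TensorProduct.tmul_sub]
    abel

/-- The coproduct `Δ : U L → U L ⊗ U L`, the algebra homomorphism with
`Δ(a) = a ⊗ 1 + 1 ⊗ a` for `a ∈ L`. -/
def comul (L : Type*) [LieRing L] [LieAlgebra ℂ L] : U L →ₐ[ℂ] U L ⊗[ℂ] U L :=
  UniversalEnvelopingAlgebra.lift ℂ (comulLie L)

/-- The diagonal action of `S ⊆ L` on `(U L)^{⊗ k}` is `a · x = [∑_j a_j, x]`, where `a_j` is `a` in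
the slot `j`; this is the algebra of elements `x` that are killed by every `a ∈ S`. -/
def invariants (k : ℕ) (S : Set L) : Subalgebra ℂ (TPow k (U L)) :=
  Subalgebra.centralizer ℂ
    ((fun a => ∑ j : Fin k, slot j (UniversalEnvelopingAlgebra.ι ℂ a)) '' S)

end Enveloping

/-! ### The subalgebras attached to a subdiagram, and the Harish-Chandra maps -/

section HarishChandra

open LieAlgebra

variable {g : Type*} [LieRing g] [LieAlgebra ℂ g] [FiniteDimensional ℂ g] [IsSemisimple ℂ g]
variable (H : LieSubalgebra ℂ g) [H.IsCartanSubalgebra]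

/-- The diagrammatic subalgebra `g_D`, generated by the root vectors for `±α`, where `α` ranges over
the simple roots in `D`. -/
def diagSubalgebra (D : Finset H.root) : LieSubalgebra ℂ g :=
  LieSubalgebra.lieSpan ℂ g
    {e | ∃ α ∈ D, e ∈ rootSpace H (α.1 : H → ℂ) ∨ e ∈ rootSpace H (-(α.1 : H → ℂ))}

/-- The Levi subalgebra `l_D = g_D + h` (as `h` normalises `g_D`, the subalgebra generated by the
two is their sum). -/
def levi (D : Finset H.root) : LieSubalgebra ℂ g := diagSubalgebra H D ⊔ H

/-- The centre `c_D` of `l_D`, as a subset of `g`. -/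
def leviCentre (D : Finset H.root) : Set g :=
  {c | ∃ hc : c ∈ levi H D, (⟨c, hc⟩ : levi H D) ∈ center ℂ (levi H D)}

/-- The nilpotent subalgebra `n_D⁺` as a subspace: the sum of the root spaces `g_α` over the roots
`α` that are positive and are not roots of `g_D`. -/
def nilPlus (b : (IsKilling.rootSystem H).Base) (D : Finset H.root) : Submodule ℂ g :=
  ⨆ α : {α : H.root // b.IsPos α ∧
      ¬ (rootSpace H (α.1 : H → ℂ)).toSubmodule ≤ (diagSubalgebra H D).toSubmodule},
    (rootSpace H (α.1.1 : H → ℂ)).toSubmodule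

/-- `I_k = (U g^{⊗ k})^{c_D} ∩ ∑_j U g^{⊗ k} · (n_D⁺)_j`, the intersection of the invariants with a
left ideal. -/
def hcIdeal (b : (IsKilling.rootSystem H).Base) (D : Finset H.root) (k : ℕ) :
    Submodule ℂ (TPow k (U g)) :=
  Subalgebra.toSubmodule (invariants k (leviCentre H D)) ⊓
    (Ideal.span {y : TPow k (U g) | ∃ j : Fin k, ∃ e ∈ nilPlus H b D,
      y = slot j (UniversalEnvelopingAlgebra.ι ℂ e)}).restrictScalars ℂ

/-- The map `(U l_D)^{⊗ k} → (U g)^{⊗ k}` given by the inclusion `l_D ⊆ g`. -/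
def leviIncl (D : Finset H.root) (k : ℕ) : TPow k (U (levi H D)) →ₗ[ℂ] TPow k (U g) :=
  tpowMap k (uMap (levi H D).incl)

/-- `z ∈ (U l_D)^{⊗ k}` is the component of `x` along `(U g^{⊗ k})^{c_D} = I_k ⊕ (U l_D)^{⊗ k}`. -/
def IsHCProj (b : (IsKilling.rootSystem H).Base) (D : Finset H.root) {k : ℕ}
    (x : invariants k (leviCentre H D)) (z : TPow k (U (levi H D))) : Prop :=
  (x : TPow k (U g)) - leviIncl H D k z ∈ hcIdeal H b D k

/-- The generalised Harish-Chandra map `π_D^k : (U g^{⊗ k})^{c_D} → (U l_D)^{⊗ k}`, the projection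
along `I_k`. -/
def hcMap (b : (IsKilling.rootSystem H).Base) (D : Finset H.root) (k : ℕ)
    (x : invariants k (leviCentre H D)) : TPow k (U (levi H D)) :=
  Classical.epsilon fun z => IsHCProj H b D x z

/-- `p` is the projection of `l_D` onto `g_D` along the centre `c_D`. -/
def IsLeviProj (D : Finset H.root) (p : levi H D →ₗ⁅ℂ⁆ diagSubalgebra H D) : Prop :=
  (∀ y : diagSubalgebra H D, p ⟨y, (le_sup_left : diagSubalgebra H D ≤ levi H D) y.2⟩ = y) ∧
    ∀ c ∈ center ℂ (levi H D), p c = 0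

/-- The Lie algebra projection `l_D = g_D ⊕ c_D → g_D`. -/
def leviProj (D : Finset H.root) : levi H D →ₗ⁅ℂ⁆ diagSubalgebra H D :=
  Classical.epsilon fun p => IsLeviProj H D p

/-- The generalised Harish-Chandra map `π̄_D^k : (U g^{⊗ k})^{c_D} → (U g_D)^{⊗ k}`, the composition
of `π_D^k` with the map induced by the projection `l_D → g_D`. -/
def hcMapBar (b : (IsKilling.rootSystem H).Base) (D : Finset H.root) (k : ℕ)
    (x : invariants k (leviCentre H D)) : TPow k (U (diagSubalgebra H D)) :=
  tpowMap k (uMap (leviProj H D)) (hcMap H b D k x)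

end HarishChandra

end HC

end

noncomputable section

namespace HC

/-! ### Tensor powers: faces, insertions and functoriality as algebra homomorphisms -/

section TensorPowers

variable {A B : Type*} [Ring A] [Algebra ℂ A] [Ring B] [Algebra ℂ B]

/-! Once the decomposition of the invariants as `I_k ⊕ (U l_D)^{⊗ k}` is known, all the identities
follow from uniqueness. The face maps and the insertions are algebra homomorphisms that are natural
for `U l_D → U g`. Elements of the Lie algebra are primitive, so a face sends `∑_j a_j` to `∑_j a_j`
and sends the generators of the left ideal of `n_D⁺` into the next such ideal. Insertions preserve
invariants because an inserted tensor commutes with every slot it leaves empty. Hence these maps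
send invariants to invariants and `I_k` to `I_{k+1}` (or `I_l` to `I_k`), and therefore commute with
the projection. The Hochschild differential is a linear combination of them, and the barred versions
follow by naturality for `l_D → g_D`.

The decomposition rests on an element `c ∈ h` on which simple roots are `0` in `D` and `1` off `D`.
It lies in `c_D` and grades `g` as `n⁻ ⊕ l_D ⊕ n_D⁺` by eigenvalues of negative, zero and positive
real part (`isTriangular_levi`).

Existence: straightening words shows that `U g` is the left ideal of `n_D⁺` plus `U l_D` plus
elements of negative weight, and the same holds for tensor powers (`tpow_eq_top`). For a
`c`-invariant the part of negative weight vanishes modulo the ideal, as the quotient has independent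
weight spaces.

Uniqueness: in place of a PBW basis, a `g`-module structure is built directly on `U n⁻ ⊗ U l_D`, in
which `n_D⁺` kills `1 ⊗ 1`. Acting on `1 ⊗ 1` and applying the augmentation of `U n⁻` gives a
retraction `U g → U l_D` that vanishes on `U g · n_D⁺` (`IsFactorization.exists_retraction`). Its
tensor powers separate `(U l_D)^{⊗ k}` from the ideal (`tpowMap_mem_slotIdeal`).

The projection `l_D → g_D` exists because `g_D` meets `c_D` trivially, by a trace argument, and a
dimension count on coroots then gives `l_D = g_D + c_D`. -/

theorem slot_commute {k : ℕ} {i j : Fin k} (h : i ≠ j) (a b : A) :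
    Commute (slot i a : TPow k A) (slot j b) := by
  simp only [Commute, SemiconjBy, PiTensorProduct.singleAlgHom_apply,
    PiTensorProduct.tprod_mul_tprod]
  exact congrArg _ (Pi.mulSingle_commute (f := fun _ : Fin k => A) h a b).eq

/-- Sorting the interleaved product only moves factors with distinct indices past each other, so
nothing is needed for `i = j`. This is what makes `ordProd` multiplicative. -/
theorem prod_ofFn_mul {M : Type*} [Monoid M] :
    ∀ {k : ℕ} (f g : Fin k → M), (∀ i j, i ≠ j → Commute (f i) (g j)) →
      (List.ofFn fun j => f j * g j).prod = (List.ofFn f).prod * (List.ofFn g).prod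
  | 0, _, _, _ => by simp
  | k + 1, f, g, h => by
    simp only [List.ofFn_succ, List.prod_cons]
    rw [prod_ofFn_mul (fun j => f j.succ) (fun j => g j.succ)
      fun i j hij => h _ _ fun e => hij (Fin.succ_injective _ e)]
    have : Commute (g 0) (List.ofFn fun j : Fin k => f j.succ).prod := by
      apply Commute.list_prod_right
      intro x hx
      obtain ⟨j, rfl⟩ := (List.mem_ofFn' _ _).1 hx
      exact (h _ _ (Fin.succ_ne_zero j)).symm
    simp only [mul_assoc]
    rw [← mul_assoc (g 0), this.eq, mul_assoc]

/-- If the images of the maps `φ j` commute, then `ordProd φ` is an algebra homomorphism. -/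
def ordProdAlg {k : ℕ} (φ : Fin k → A →ₐ[ℂ] B)
    (h : ∀ i j, i ≠ j → ∀ a b, Commute (φ i a) (φ j b)) : TPow k A →ₐ[ℂ] B :=
  PiTensorProduct.liftAlgHom
    ((MultilinearMap.mkPiAlgebraFin ℂ k B).compLinearMap fun j => (φ j).toLinearMap)
    (by simp [MultilinearMap.mkPiAlgebraFin_apply])
    (fun x y => by
      simp only [MultilinearMap.compLinearMap_apply, MultilinearMap.mkPiAlgebraFin_apply,
        AlgHom.toLinearMap_apply, Pi.mul_apply, map_mul]
      exact prod_ofFn_mul _ _ fun i j hij => h i j hij _ _)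

theorem ordProd_slot {k : ℕ} (φ : Fin k → A →ₐ[ℂ] B) (j : Fin k) (a : A) :
    ordProd φ (slot j a) = φ j a := by
  simp only [ordProd, PiTensorProduct.singleAlgHom_apply, PiTensorProduct.lift.tprod,
    MultilinearMap.compLinearMap_apply, MultilinearMap.mkPiAlgebraFin_apply,
    AlgHom.toLinearMap_apply, MonoidHom.mulSingle_apply]
  rw [prod_ofFn_eq_single _ j]
  · simp
  · intro m hm
    simp [hm]

theorem slotPair_tmul {k : ℕ} (i : Fin k) (a b : A) :
    slotPair i (a ⊗ₜ[ℂ] b) = slot i.castSucc a * slot i.succ b := by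
  simp only [slotPair, Algebra.TensorProduct.lift_tmul]

theorem slotPair_commute {k : ℕ} (i : Fin k) {j : Fin (k + 1)} (h₁ : j ≠ i.castSucc)
    (h₂ : j ≠ i.succ) (a : A) (t : A ⊗[ℂ] A) : Commute (slot j a) (slotPair i t) := by
  induction t with
  | zero => rw [map_zero]; exact Commute.zero_right _
  | tmul x y =>
    rw [slotPair_tmul]
    exact (slot_commute h₁ _ _).mul_right (slot_commute h₂ _ _)
  | add x y hx hy => rw [map_add]; exact hx.add_right hy

/-- The restriction of the face map to the slot `j`. -/
def faceSlot (Δ : A →ₐ[ℂ] A ⊗[ℂ] A) {k : ℕ} (i j : Fin k) : A →ₐ[ℂ] TPow (k + 1) A :=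
  if j < i then slot j.castSucc else if i < j then slot j.succ else (slotPair i).comp Δ

theorem faceSlot_lt (Δ : A →ₐ[ℂ] A ⊗[ℂ] A) {k : ℕ} {i j : Fin k} (h : j < i) :
    faceSlot Δ i j = slot j.castSucc := if_pos h

theorem faceSlot_gt (Δ : A →ₐ[ℂ] A ⊗[ℂ] A) {k : ℕ} {i j : Fin k} (h : i < j) :
    faceSlot Δ i j = slot j.succ := by
  rw [faceSlot, if_neg h.not_gt, if_pos h]

theorem faceSlot_self (Δ : A →ₐ[ℂ] A ⊗[ℂ] A) {k : ℕ} (i : Fin k) :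
    faceSlot Δ i i = (slotPair i).comp Δ := by simp [faceSlot]

/-- Distinct slots are sent to disjoint sets of slots: `i` goes to `{i, i + 1}`, and the others to
one slot each outside that set. -/
theorem faceSlot_commute (Δ : A →ₐ[ℂ] A ⊗[ℂ] A) {k : ℕ} (i : Fin k) {j m : Fin k} (h : j ≠ m)
    (a b : A) : Commute (faceSlot Δ i j a) (faceSlot Δ i m b) := by
  have key : ∀ {j m : Fin k} (a b : A), j < m →
      Commute (faceSlot Δ i j a) (faceSlot Δ i m b) := by
    intro j m a b h
    rcases lt_trichotomy j i with hj | hj | hj <;> rcases lt_trichotomy m i with hm | hm | hm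
    · rw [faceSlot_lt Δ hj, faceSlot_lt Δ hm]
      exact slot_commute (by simpa using h.ne) _ _
    · rw [faceSlot_lt Δ hj, hm, faceSlot_self]
      apply slotPair_commute <;> simp only [ne_eq, Fin.ext_iff, Fin.val_castSucc, Fin.val_succ] <;>
        omega
    · rw [faceSlot_lt Δ hj, faceSlot_gt Δ hm]
      apply slot_commute
      simp only [ne_eq, Fin.ext_iff, Fin.val_castSucc, Fin.val_succ]
      omega
    · omega
    · omega
    · rw [hj, faceSlot_self, faceSlot_gt Δ hm]
      apply Commute.symm
      apply slotPair_commute <;> simp only [ne_eq, Fin.ext_iff, Fin.val_castSucc, Fin.val_succ] <;>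
        omega
    · omega
    · omega
    · rw [faceSlot_gt Δ hj, faceSlot_gt Δ hm]
      exact slot_commute (by simpa using h.ne) _ _
  rcases lt_or_gt_of_ne h with h | h
  · exact key a b h
  · exact (key b a h).symm

/-- The face map as an algebra homomorphism. -/
def faceAlg (Δ : A →ₐ[ℂ] A ⊗[ℂ] A) {k : ℕ} (i : Fin k) : TPow k A →ₐ[ℂ] TPow (k + 1) A :=
  ordProdAlg (faceSlot Δ i) fun _ _ h => faceSlot_commute Δ i h

theorem faceAlg_apply (Δ : A →ₐ[ℂ] A ⊗[ℂ] A) {k : ℕ} (i : Fin k) (x : TPow k A) :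
    faceAlg Δ i x = faceMap Δ i x := rfl

theorem faceAlg_slot (Δ : A →ₐ[ℂ] A ⊗[ℂ] A) {k : ℕ} (i j : Fin k) (a : A) :
    faceAlg Δ i (slot j a) = faceSlot Δ i j a := ordProd_slot _ _ _

/-- The insertion as an algebra homomorphism. -/
def insertAlg {l k : ℕ} (i : ℕ) (h : i + l ≤ k) : TPow l A →ₐ[ℂ] TPow k A :=
  ordProdAlg (fun m : Fin l => slot ⟨i + m, by omega⟩) fun m n hmn => slot_commute (by
    simp only [ne_eq, Fin.ext_iff] at *; omega)

theorem insertAlg_apply {l k : ℕ} (i : ℕ) (h : i + l ≤ k) (x : TPow l A) :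
    insertAlg i h x = insertOnes i h x := rfl

theorem insertAlg_slot {l k : ℕ} (i : ℕ) (h : i + l ≤ k) (m : Fin l) (a : A) :
    insertAlg i h (slot m a) = slot ⟨i + m, by omega⟩ a := ordProd_slot _ _ _

/-- The map `φ^{⊗ k}` as an algebra homomorphism. -/
def tpowAlg (k : ℕ) (φ : A →ₐ[ℂ] B) : TPow k A →ₐ[ℂ] TPow k B :=
  ordProdAlg (fun j => (slot j).comp φ) fun _ _ h _ _ => slot_commute h _ _

theorem tpowAlg_slot (k : ℕ) (φ : A →ₐ[ℂ] B) (j : Fin k) (a : A) :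
    tpowAlg k φ (slot j a) = slot j (φ a) := ordProd_slot _ _ _

theorem prod_ofFn_mulSingle {M : Type*} [Monoid M] {k : ℕ} (x : Fin k → M) (m : Fin k) :
    (List.ofFn fun j => (Pi.mulSingle j (x j) : Fin k → M) m).prod = x m := by
  rw [prod_ofFn_eq_single _ m]
  · simp
  · intro j hj
    rw [Pi.mulSingle_apply, if_neg hj.symm]

/-- The two maps have different constructions, an ordered product of slots and
`PiTensorProduct.map`, so they are compared on pure tensors. -/
theorem tpowAlg_apply (k : ℕ) (φ : A →ₐ[ℂ] B) (x : TPow k A) :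
    tpowAlg k φ x = tpowMap k φ x := by
  suffices (tpowAlg k φ).toLinearMap = tpowMap k φ from DFunLike.congr_fun this x
  apply PiTensorProduct.ext
  ext x
  change ordProd (fun j => (slot j).comp φ) (PiTensorProduct.tprod ℂ x) =
    PiTensorProduct.map (fun _ => φ.toLinearMap) (PiTensorProduct.tprod ℂ x)
  simp only [PiTensorProduct.map_tprod, ordProd, PiTensorProduct.lift.tprod,
    MultilinearMap.compLinearMap_apply, MultilinearMap.mkPiAlgebraFin_apply,
    AlgHom.toLinearMap_apply, AlgHom.comp_apply, PiTensorProduct.singleAlgHom_apply,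
    MonoidHom.mulSingle_apply]
  rw [prod_ofFn_tprod]
  congr 1
  funext m
  exact prod_ofFn_mulSingle _ m

theorem tpowAlg_slotPair {k : ℕ} (φ : A →ₐ[ℂ] B) (i : Fin k) (t : A ⊗[ℂ] A) :
    tpowAlg (k + 1) φ (slotPair i t) = slotPair i (Algebra.TensorProduct.map φ φ t) := by
  induction t with
  | zero => simp only [map_zero]
  | tmul x y =>
    rw [Algebra.TensorProduct.map_tmul, slotPair_tmul, slotPair_tmul, map_mul, tpowAlg_slot,
      tpowAlg_slot]
  | add x y hx hy => simp only [map_add, hx, hy]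

/-- The face maps are natural. -/
theorem faceMap_tpowMap (φ : A →ₐ[ℂ] B) (Δ : A →ₐ[ℂ] A ⊗[ℂ] A) (Δ' : B →ₐ[ℂ] B ⊗[ℂ] B)
    (h : (Algebra.TensorProduct.map φ φ).comp Δ = Δ'.comp φ) {k : ℕ} (i : Fin k) (x : TPow k A) :
    faceMap Δ' i (tpowMap k φ x) = tpowMap (k + 1) φ (faceMap Δ i x) := by
  rw [← tpowAlg_apply, ← tpowAlg_apply, ← faceAlg_apply, ← faceAlg_apply]
  suffices (faceAlg Δ' i).comp (tpowAlg k φ) = (tpowAlg (k + 1) φ).comp (faceAlg Δ i) from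
    DFunLike.congr_fun this x
  -- Both sides are algebra homomorphisms, so agreement on each slot suffices.
  apply PiTensorProduct.algHom_ext
  intro j
  ext a
  change faceAlg Δ' i (tpowAlg k φ (slot j a)) = tpowAlg (k + 1) φ (faceAlg Δ i (slot j a))
  rw [tpowAlg_slot, faceAlg_slot, faceAlg_slot]
  rcases lt_trichotomy j i with hj | rfl | hj
  · rw [faceSlot_lt _ hj, faceSlot_lt _ hj, tpowAlg_slot]
  · rw [faceSlot_self, faceSlot_self, AlgHom.comp_apply, AlgHom.comp_apply, tpowAlg_slotPair]
    exact congrArg _ (DFunLike.congr_fun h a).symm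
  · rw [faceSlot_gt _ hj, faceSlot_gt _ hj, tpowAlg_slot]

/-- The insertions are natural. -/
theorem insertOnes_tpowMap (φ : A →ₐ[ℂ] B) {l k : ℕ} (i : ℕ) (h : i + l ≤ k) (x : TPow l A) :
    insertOnes i h (tpowMap l φ x) = tpowMap k φ (insertOnes i h x) := by
  rw [← tpowAlg_apply, ← tpowAlg_apply, ← insertAlg_apply, ← insertAlg_apply]
  suffices (insertAlg i h).comp (tpowAlg l φ) = (tpowAlg k φ).comp (insertAlg i h) from
    DFunLike.congr_fun this x
  apply PiTensorProduct.algHom_ext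
  intro j
  ext a
  change insertAlg i h (tpowAlg l φ (slot j a)) = tpowAlg k φ (insertAlg i h (slot j a))
  rw [tpowAlg_slot, insertAlg_slot, insertAlg_slot, tpowAlg_slot]

/-- The Hochschild differential is natural. -/
theorem hochschild_tpowMap (φ : A →ₐ[ℂ] B) (Δ : A →ₐ[ℂ] A ⊗[ℂ] A) (Δ' : B →ₐ[ℂ] B ⊗[ℂ] B)
    (h : (Algebra.TensorProduct.map φ φ).comp Δ = Δ'.comp φ) (k : ℕ) (x : TPow k A) :
    hochschild Δ' k (tpowMap k φ x) = tpowMap (k + 1) φ (hochschild Δ k x) := by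
  simp only [hochschild, LinearMap.add_apply, LinearMap.smul_apply, LinearMap.sum_apply, map_add,
    map_smul, map_sum, insertOnes_tpowMap, faceMap_tpowMap φ Δ Δ' h]

/-- Outside the window `i, …, i + l - 1` the inserted tensor has the entry `1`. -/
theorem insertOnes_commute_slot {l k : ℕ} (i : ℕ) (h : i + l ≤ k) (x : TPow l A) (j : Fin k)
    (hj : ¬ (i ≤ j ∧ (j : ℕ) < i + l)) (a : A) : Commute (slot j a) (insertOnes i h x) := by
  induction x using PiTensorProduct.induction_on with
  | smul_tprod r f =>
    rw [map_smul, insertOnes_tprod]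
    refine Commute.smul_right (Commute.tprod ?_) r
    refine funext fun m => ?_
    simp only [Pi.mul_apply, MonoidHom.mulSingle_apply]
    rcases eq_or_ne m j with rfl | hm
    · rw [dif_neg hj]; simp
    · simp [hm]
  | add x y hx hy => rw [map_add]; exact hx.add_right hy

end TensorPowers

/-! ### Faces and insertions preserve invariants and the left ideals -/

section Enveloping

attribute [local instance 100] LieRing.ofAssociativeRing

variable {L L' : Type*} [LieRing L] [LieAlgebra ℂ L] [LieRing L'] [LieAlgebra ℂ L']

theorem uMap_ι (f : L →ₗ⁅ℂ⁆ L') (x : L) :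
    uMap f (UniversalEnvelopingAlgebra.ι ℂ x) = UniversalEnvelopingAlgebra.ι ℂ (f x) := by
  rw [uMap, UniversalEnvelopingAlgebra.lift_ι_apply]; rfl

theorem comul_ι (x : L) : comul L (UniversalEnvelopingAlgebra.ι ℂ x) =
    UniversalEnvelopingAlgebra.ι ℂ x ⊗ₜ 1 + 1 ⊗ₜ UniversalEnvelopingAlgebra.ι ℂ x := by
  rw [comul, UniversalEnvelopingAlgebra.lift_ι_apply]; rfl

theorem comul_uMap (f : L →ₗ⁅ℂ⁆ L') :
    (Algebra.TensorProduct.map (uMap f) (uMap f)).comp (comul L) = (comul L').comp (uMap f) := by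
  apply UniversalEnvelopingAlgebra.hom_ext
  ext x
  change Algebra.TensorProduct.map (uMap f) (uMap f) (comul L (UniversalEnvelopingAlgebra.ι ℂ x)) =
    comul L' (uMap f (UniversalEnvelopingAlgebra.ι ℂ x))
  rw [uMap_ι, comul_ι, comul_ι, map_add, Algebra.TensorProduct.map_tmul,
    Algebra.TensorProduct.map_tmul, uMap_ι, map_one]

/-- The element `∑_j a_j` of `(U L)^{⊗ k}`. -/
def diag (k : ℕ) (a : L) : TPow k (U L) := ∑ j : Fin k, slot j (UniversalEnvelopingAlgebra.ι ℂ a)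

theorem mem_invariants {k : ℕ} {S : Set L} {x : TPow k (U L)} :
    x ∈ invariants k S ↔ ∀ a ∈ S, diag k a * x = x * diag k a := by
  rw [invariants, Subalgebra.mem_centralizer_iff, Set.forall_mem_image]; rfl

theorem slotPair_comul_ι {k : ℕ} (i : Fin k) (a : L) :
    slotPair i (comul L (UniversalEnvelopingAlgebra.ι ℂ a)) =
      slot i.castSucc (UniversalEnvelopingAlgebra.ι ℂ a) +
        slot i.succ (UniversalEnvelopingAlgebra.ι ℂ a) := by
  rw [comul_ι, map_add, slotPair_tmul, slotPair_tmul, map_one, map_one, mul_one, one_mul]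

/-- Primitivity of `a`: slot `i` contributes the two terms in slots `i` and `i + 1`, and the other
slots of the target are each hit once. Invariance of faces is a formal consequence, as the face is
multiplicative. -/
theorem faceAlg_diag {k : ℕ} (i : Fin k) (a : L) :
    faceAlg (comul L) i (diag k a) = diag (k + 1) a := by
  rw [diag, map_sum, diag, Fin.sum_univ_succAbove _ i.castSucc, ← Finset.add_sum_erase _ _
    (Finset.mem_univ i), ← Finset.add_sum_erase _ _ (Finset.mem_univ i), ← add_assoc]
  simp only [faceAlg_slot]
  congr 1
  · rw [faceSlot_self, AlgHom.comp_apply, slotPair_comul_ι, Fin.succAbove_castSucc_self]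
  · refine Finset.sum_congr rfl fun j hj => ?_
    rcases lt_or_gt_of_ne (Finset.ne_of_mem_erase hj) with h | h
    · rw [faceSlot_lt _ h, Fin.succAbove_of_castSucc_lt _ _ h]
    · rw [faceSlot_gt _ h, Fin.succAbove_of_le_castSucc _ _ (le_of_lt h)]

theorem faceMap_mem_invariants {k : ℕ} {S : Set L} (i : Fin k) {x : TPow k (U L)}
    (hx : x ∈ invariants k S) : faceMap (comul L) i x ∈ invariants (k + 1) S := by
  rw [mem_invariants] at hx ⊢
  intro a ha
  rw [← faceAlg_apply, ← faceAlg_diag i, ← map_mul, hx a ha, map_mul]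

theorem insertOnes_mem_invariants {l k : ℕ} {S : Set L} (i : ℕ) (h : i + l ≤ k)
    {x : TPow l (U L)} (hx : x ∈ invariants l S) : insertOnes i h x ∈ invariants k S := by
  rw [mem_invariants] at hx ⊢
  intro a ha
  let e : Fin l ↪ Fin k := ⟨fun m => ⟨i + m, by omega⟩, fun m n hmn => by
    simp only [Fin.mk.injEq] at hmn; exact Fin.ext (by omega)⟩
  -- The diagonal element splits into its occupied slots, where it is the image of the smaller
  -- diagonal element, and its empty slots, which commute with the inserted tensor term by term.
  have h₁ : Commute (∑ j ∈ Finset.univ.map e, slot j (UniversalEnvelopingAlgebra.ι ℂ a))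
      (insertOnes i h x) := by
    have : ∑ j ∈ Finset.univ.map e, slot j (UniversalEnvelopingAlgebra.ι ℂ a) =
        insertAlg i h (diag l a) := by
      rw [Finset.sum_map, diag, map_sum]
      exact Finset.sum_congr rfl fun m _ => (insertAlg_slot _ _ _ _).symm
    rw [this, ← insertAlg_apply]
    exact (show Commute (diag l a) x from hx a ha).map (insertAlg i h)
  have h₂ : Commute (∑ j ∈ (Finset.univ.map e)ᶜ, slot j (UniversalEnvelopingAlgebra.ι ℂ a))
      (insertOnes i h x) := by
    refine Commute.sum_left _ _ _ fun j hj => insertOnes_commute_slot i h x j ?_ _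
    rintro ⟨h₁, h₂⟩
    simp only [Finset.mem_compl, Finset.mem_map, Finset.mem_univ, true_and, not_exists] at hj
    exact hj ⟨j - i, by omega⟩ (Fin.ext (show i + (j - i) = (j : ℕ) by omega))
  have := h₁.add_left h₂
  rw [Finset.sum_add_sum_compl] at this
  exact this

theorem hochschild_mem_invariants {k : ℕ} {S : Set L} {x : TPow k (U L)}
    (hx : x ∈ invariants k S) : hochschild (comul L) k x ∈ invariants (k + 1) S := by
  simp only [hochschild, LinearMap.add_apply, LinearMap.smul_apply, LinearMap.sum_apply]
  refine add_mem (add_mem (insertOnes_mem_invariants _ _ hx) (sum_mem fun i _ => ?_)) ?_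
  · exact Subalgebra.smul_mem _ (faceMap_mem_invariants i hx) _
  · exact Subalgebra.smul_mem _ (insertOnes_mem_invariants _ _ hx) _

/-- The left ideal `∑_j (U L)^{⊗ k} · N_j`. -/
def slotIdeal (N : Submodule ℂ L) (k : ℕ) : Ideal (TPow k (U L)) :=
  Ideal.span {y | ∃ j : Fin k, ∃ e ∈ N, y = slot j (UniversalEnvelopingAlgebra.ι ℂ e)}

theorem slot_mem_slotIdeal {N : Submodule ℂ L} {k : ℕ} (j : Fin k) {e : L} (he : e ∈ N) :
    slot j (UniversalEnvelopingAlgebra.ι ℂ e) ∈ slotIdeal N k :=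
  Ideal.subset_span ⟨j, e, he, rfl⟩

/-- The preimage of a left ideal under an algebra homomorphism is a left ideal, so only generators
matter. Primitivity sends a generator to a generator or to a sum of two. -/
theorem faceMap_mem_slotIdeal {N : Submodule ℂ L} {k : ℕ} (i : Fin k) {x : TPow k (U L)}
    (hx : x ∈ slotIdeal N k) : faceMap (comul L) i x ∈ slotIdeal N (k + 1) := by
  suffices slotIdeal N k ≤ (slotIdeal N (k + 1)).comap (faceAlg (comul L) i) from this hx
  rw [slotIdeal, Ideal.span_le]
  rintro _ ⟨j, e, he, rfl⟩
  change faceAlg (comul L) i _ ∈ slotIdeal N (k + 1)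
  rw [faceAlg_slot]
  rcases lt_trichotomy j i with hj | rfl | hj
  · rw [faceSlot_lt _ hj]; exact slot_mem_slotIdeal _ he
  · rw [faceSlot_self, AlgHom.comp_apply, slotPair_comul_ι]
    exact add_mem (slot_mem_slotIdeal _ he) (slot_mem_slotIdeal _ he)
  · rw [faceSlot_gt _ hj]; exact slot_mem_slotIdeal _ he

theorem insertOnes_mem_slotIdeal {N : Submodule ℂ L} {l k : ℕ} (i : ℕ) (h : i + l ≤ k)
    {x : TPow l (U L)} (hx : x ∈ slotIdeal N l) : insertOnes i h x ∈ slotIdeal N k := by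
  suffices slotIdeal N l ≤ (slotIdeal N k).comap (insertAlg i h) from this hx
  rw [slotIdeal, Ideal.span_le]
  rintro _ ⟨j, e, he, rfl⟩
  change insertAlg i h _ ∈ slotIdeal N k
  rw [insertAlg_slot]
  exact slot_mem_slotIdeal _ he

theorem hochschild_mem_slotIdeal {N : Submodule ℂ L} {k : ℕ} {x : TPow k (U L)}
    (hx : x ∈ slotIdeal N k) : hochschild (comul L) k x ∈ slotIdeal N (k + 1) := by
  have hs : ∀ (r : ℂ) {y}, y ∈ slotIdeal N (k + 1) → r • y ∈ slotIdeal N (k + 1) := fun r _ hy =>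
    ((slotIdeal N (k + 1)).restrictScalars ℂ).smul_mem r hy
  simp only [hochschild, LinearMap.add_apply, LinearMap.smul_apply, LinearMap.sum_apply]
  refine add_mem (add_mem (insertOnes_mem_slotIdeal _ _ hx) (sum_mem fun i _ => ?_)) ?_
  · exact hs _ (faceMap_mem_slotIdeal i hx)
  · exact hs _ (insertOnes_mem_slotIdeal _ _ hx)

end Enveloping

/-! ### A module on `U a ⊗ U l` and the retraction of `U L` onto `U l` -/

section Factorization

attribute [local instance 100] LieRing.ofAssociativeRing

open UniversalEnvelopingAlgebra (ι)

section Induction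

variable {L : Type*} [LieRing L] [LieAlgebra ℂ L]

/-- The universal property gives a homomorphism `U L → S` whose composite with the inclusion is the
identity, by uniqueness. -/
theorem subalgebra_eq_top_of_ι_mem (S : Subalgebra ℂ (U L)) (h : ∀ x, ι ℂ x ∈ S) : S = ⊤ := by
  let f : L →ₗ⁅ℂ⁆ S :=
    { toFun x := ⟨ι ℂ x, h x⟩
      map_add' x y := Subtype.ext (by simp)
      map_smul' r x := Subtype.ext (by simp)
      map_lie' {x y} := Subtype.ext (by
        simp [LieRing.of_associative_ring_bracket]) }
  have hf : S.val.comp (UniversalEnvelopingAlgebra.lift ℂ f) = AlgHom.id ℂ (U L) := by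
    apply UniversalEnvelopingAlgebra.hom_ext
    ext x
    change S.val (UniversalEnvelopingAlgebra.lift ℂ f (ι ℂ x)) = ι ℂ x
    rw [UniversalEnvelopingAlgebra.lift_ι_apply]; rfl
  rw [eq_top_iff]
  intro u _
  rw [← AlgHom.id_apply (R := ℂ) u, ← hf]
  exact Subtype.prop _

/-- A subspace of `U L` that contains `1` and is stable under left multiplication by `L` is
everything. -/
theorem submodule_eq_top_of_ι_mul_mem (S : Submodule ℂ (U L)) (h₁ : 1 ∈ S)
    (h : ∀ x, ∀ u ∈ S, ι ℂ x * u ∈ S) : S = ⊤ := by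
  -- The elements whose left multiplication preserves `S` form a subalgebra containing `L`; apply
  -- them to `1 ∈ S`.
  let T : Subalgebra ℂ (U L) :=
    { carrier := {v | ∀ u ∈ S, v * u ∈ S}
      mul_mem' := fun {v w} hv hw u hu => by rw [mul_assoc]; exact hv _ (hw _ hu)
      add_mem' := fun {v w} hv hw u hu => by rw [add_mul]; exact S.add_mem (hv _ hu) (hw _ hu)
      algebraMap_mem' := fun r u hu => by
        rw [← Algebra.smul_def]; exact S.smul_mem r hu }
  have hT : T = ⊤ := subalgebra_eq_top_of_ι_mem T h
  rw [eq_top_iff]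
  intro u _
  have : u ∈ T := hT ▸ Algebra.mem_top
  simpa using this 1 h₁

end Induction

variable {L : Type*} [LieRing L] [LieAlgebra ℂ L] {a l : LieSubalgebra ℂ L}

/-- Left multiplication on the first factor of `U a ⊗ V`. -/
def leftMul (V : Type*) [AddCommGroup V] [Module ℂ V] :
    U a →ₐ[ℂ] Module.End ℂ (U a ⊗[ℂ] V) :=
  (Module.End.rTensorAlgHom ℂ (U a) V).comp (Algebra.lmul ℂ (U a))

@[simp] theorem leftMul_tmul {V : Type*} [AddCommGroup V] [Module ℂ V] (u u' : U a) (v : V) :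
    leftMul V u (u' ⊗ₜ v) = (u * u') ⊗ₜ v := rfl

/-- The action of `a` on the space of linear maps `L → U a ⊗ V`. -/
def homAction (V : Type*) [AddCommGroup V] [Module ℂ V] :
    a →ₗ⁅ℂ⁆ Module.End ℂ (L →ₗ[ℂ] U a ⊗[ℂ] V) where
  toFun y := LinearMap.compRight ℂ (leftMul V (ι ℂ y)) -
    LinearMap.lcomp ℂ _ (LieAlgebra.ad ℂ L (y : L))
  map_add' y y' := by
    ext f x
    simp
    abel
  map_smul' r y := by
    ext f x
    simp [smul_sub]
  map_lie' {y y'} := by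
    ext f x
    simp [LieRing.of_associative_ring_bracket]
    abel

variable (pa : L →ₗ[ℂ] a) (pl : L →ₗ[ℂ] l)

/-- The action of `L` on `1 ⊗ U l`. -/
def baseAction : U l →ₗ[ℂ] L →ₗ[ℂ] U a ⊗[ℂ] U l :=
  (LinearMap.mk₂ ℂ (fun (x : L) (v : U l) => ι ℂ (pa x) ⊗ₜ[ℂ] v + 1 ⊗ₜ[ℂ] (ι ℂ (pl x) * v))
    (fun x x' v => by
      simp only [map_add, TensorProduct.add_tmul, add_mul, TensorProduct.tmul_add]; abel)
    (fun r x v => by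
      simp only [map_smul, ← TensorProduct.smul_tmul', smul_mul_assoc, TensorProduct.tmul_smul,
        smul_add])
    (fun x v v' => by
      simp only [TensorProduct.tmul_add, mul_add]; abel)
    (fun r x v => by
      simp only [TensorProduct.tmul_smul, mul_smul_comm, smul_add])).flip

/-- The extension of `baseAction` to `U a ⊗ U l` that is equivariant for `a`. -/
def extAction : U a ⊗[ℂ] U l →ₗ[ℂ] L →ₗ[ℂ] U a ⊗[ℂ] U l :=
  TensorProduct.lift ((LinearMap.lcomp ℂ _ (baseAction pa pl)).comp
    (UniversalEnvelopingAlgebra.lift ℂ (homAction (U l))).toLinearMap)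

theorem extAction_tmul (u : U a) (v : U l) : extAction pa pl (u ⊗ₜ v) =
    UniversalEnvelopingAlgebra.lift ℂ (homAction (U l)) u (baseAction pa pl v) := rfl

theorem extAction_one_tmul (v : U l) (x : L) : extAction pa pl (1 ⊗ₜ v) x =
    ι ℂ (pa x) ⊗ₜ[ℂ] v + 1 ⊗ₜ[ℂ] (ι ℂ (pl x) * v) := by
  rw [extAction_tmul, map_one]; rfl

/-- This is the relation `x · (y m) = y (x · m) - [y, x] · m`, which any module structure with `a`
acting by left multiplication must satisfy. It determines the action from its values on `1 ⊗ U l`,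
and `homAction` is chosen to encode it. -/
theorem extAction_leftMul (y : a) (m : U a ⊗[ℂ] U l) (x : L) :
    extAction pa pl (leftMul (U l) (ι ℂ y) m) x =
      leftMul (U l) (ι ℂ y) (extAction pa pl m x) - extAction pa pl m ⁅(y : L), x⁆ := by
  induction m with
  | zero => simp
  | tmul u v =>
    rw [leftMul_tmul, extAction_tmul, map_mul, UniversalEnvelopingAlgebra.lift_ι_apply]
    rfl
  | add m m' h h' =>
    simp only [map_add, LinearMap.add_apply, h, h']
    abel

/-- Induction on `U a ⊗ V`. -/
theorem tensor_induction {V : Type*} [AddCommGroup V] [Module ℂ V] {p : U a ⊗[ℂ] V → Prop}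
    (zero : p 0) (add : ∀ m m', p m → p m' → p (m + m'))
    (one : ∀ v, p (1 ⊗ₜ v)) (mul : ∀ (y : a) m, p m → p (leftMul V (ι ℂ y) m)) (m) : p m := by
  have smul : ∀ u : U a, ∀ v, p (u ⊗ₜ[ℂ] v) := by
    let S : Submodule ℂ (U a) :=
      { carrier := {u | ∀ v, p (u ⊗ₜ[ℂ] v)}
        add_mem' := fun {u u'} h h' v => by rw [TensorProduct.add_tmul]; exact add _ _ (h v) (h' v)
        zero_mem' := fun v => by rw [TensorProduct.zero_tmul]; exact zero
        smul_mem' := fun r u h v => by rw [TensorProduct.smul_tmul]; exact h _ }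
    have : S = ⊤ := submodule_eq_top_of_ι_mul_mem S one fun y u hu v => by
      rw [← leftMul_tmul]; exact mul y _ (hu v)
    intro u
    exact (this ▸ Submodule.mem_top : u ∈ S)
  induction m with
  | zero => exact zero
  | tmul u v => exact smul u v
  | add m m' h h' => exact add _ _ h h'

/-- The data of projections `pa`, `pl` along a decomposition `L = a ⊕ l ⊕ n`, where `n` and `l ⊕ n`
are subalgebras and `n` is an ideal of `l ⊕ n`. -/
structure IsFactorization : Prop where
  pa_coe_a : ∀ y : a, pa y = y
  pl_coe_a : ∀ y : a, pl y = 0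
  pa_coe_l : ∀ z : l, pa z = 0
  pl_coe_l : ∀ z : l, pl z = z
  pa_lie : ∀ x x', pa x = 0 → pa x' = 0 → pa ⁅x, x'⁆ = 0
  pl_lie : ∀ x x', pa x = 0 → pa x' = 0 → pl ⁅x, x'⁆ = ⁅pl x, pl x'⁆

variable {pa pl} (h : IsFactorization pa pl)
include h

/-- The relation of `extAction_leftMul` propagates this from `1 ⊗ U l`: `y' y m - [y', y] m = y y'
m`. -/
theorem IsFactorization.extAction_coe (y : a) (m : U a ⊗[ℂ] U l) :
    extAction pa pl m y = leftMul (U l) (ι ℂ y) m := by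
  induction m using tensor_induction generalizing y with
  | zero => simp
  | add m m' h h' => simp only [map_add, LinearMap.add_apply, h, h']
  | one v => rw [extAction_one_tmul, h.pa_coe_a, h.pl_coe_a]; simp
  | mul y' m ih =>
    rw [extAction_leftMul, ih, ← LieSubalgebra.coe_bracket, ih, LieHom.map_lie,
      LieRing.of_associative_ring_bracket]
    simp

/-- If one argument lies in `a`, this is the defining equivariance. On `1 ⊗ U l` with both arguments
in `ker pa`, only `pl` acts, and `pl` respects brackets there. The Jacobi identity carries the
result to all of `U a ⊗ U l`. -/
theorem IsFactorization.extAction_lie (x x' : L) (m : U a ⊗[ℂ] U l) :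
    extAction pa pl m ⁅x, x'⁆ =
      extAction pa pl (extAction pa pl m x') x - extAction pa pl (extAction pa pl m x) x' := by
  have hskew : ∀ (m) (y : a) (x : L), extAction pa pl m ⁅(y : L), x⁆ =
      extAction pa pl (extAction pa pl m x) y - extAction pa pl (extAction pa pl m y) x := by
    intro m y x
    rw [h.extAction_coe y m, extAction_leftMul, h.extAction_coe]
    abel
  induction m using tensor_induction generalizing x x' with
  | zero => simp
  | add m m' h h' => simp only [map_add, LinearMap.add_apply, h, h']; abel
  | one v =>
    have hq : ∀ x x', pa x = 0 → pa x' = 0 → extAction pa pl (1 ⊗ₜ v) ⁅x, x'⁆ =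
      extAction pa pl (extAction pa pl (1 ⊗ₜ v) x') x -
        extAction pa pl (extAction pa pl (1 ⊗ₜ v) x) x' := by
      intro x x' hx hx'
      simp only [extAction_one_tmul, h.pa_lie x x' hx hx', h.pl_lie x x' hx hx', hx, hx',
        map_zero, TensorProduct.zero_tmul, zero_add, LieHom.map_lie,
        LieRing.of_associative_ring_bracket, sub_mul, TensorProduct.tmul_sub, mul_assoc]
    have hdec : ∀ x, ∃ (y : a) (q : L), pa q = 0 ∧ x = y + q := fun x =>
      ⟨pa x, x - pa x, by rw [map_sub, h.pa_coe_a, sub_self], by abel⟩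
    obtain ⟨y, q, hq₀, rfl⟩ := hdec x
    obtain ⟨y', q', hq₀', rfl⟩ := hdec x'
    have h₃ := hskew (1 ⊗ₜ v) y' q
    rw [← lie_skew, map_neg, neg_eq_iff_eq_neg] at h₃
    simp only [add_lie, lie_add, map_add, LinearMap.add_apply, hskew _ y, hq _ _ hq₀ hq₀', h₃]
    abel
  | mul y m ih =>
    have hj : ⁅(y : L), ⁅x, x'⁆⁆ = ⁅⁅(y : L), x⁆, x'⁆ + ⁅x, ⁅(y : L), x'⁆⁆ := leibniz_lie _ _ _
    simp only [extAction_leftMul, map_sub, LinearMap.sub_apply, hj, map_add, ih]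
    abel

/-- The action of `L` on `U a ⊗ U l`. -/
def IsFactorization.action (h : IsFactorization pa pl) : L →ₗ⁅ℂ⁆ Module.End ℂ (U a ⊗[ℂ] U l) where
  toLinearMap := (extAction pa pl).flip
  map_lie' {x x'} := by
    exact LinearMap.ext fun m => h.extAction_lie x x' m

/-- If `L = a ⊕ l ⊕ n` as in `IsFactorization`, there is a linear map `U L → U l` that
restricts to the identity on `U l` and vanishes on `(U L) n`. -/
theorem IsFactorization.exists_retraction : ∃ P : U L →ₗ[ℂ] U l,
    (∀ z, P (uMap l.incl z) = z) ∧
      ∀ u, ∀ e : L, pa e = 0 → pl e = 0 → P (u * ι ℂ e) = 0 := by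
  let ρ : U L →ₐ[ℂ] Module.End ℂ (U a ⊗[ℂ] U l) := UniversalEnvelopingAlgebra.lift ℂ h.action
  let ε : U a →ₐ[ℂ] ℂ := UniversalEnvelopingAlgebra.lift ℂ (0 : a →ₗ⁅ℂ⁆ ℂ)
  have hρ : ∀ x m, ρ (ι ℂ x) m = extAction pa pl m x := fun x m => by
    simp only [ρ, UniversalEnvelopingAlgebra.lift_ι_apply]; rfl
  -- The retraction is `u ↦ (ε ⊗ id)(u · (1 ⊗ 1))`, with `ε` the augmentation of `U a`.
  refine ⟨(TensorProduct.lid ℂ (U l)).toLinearMap ∘ₗ (ε.toLinearMap.rTensor (U l)) ∘ₗ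
    (LinearMap.applyₗ (1 ⊗ₜ 1)) ∘ₗ ρ.toLinearMap, ?_, ?_⟩
  · have hz : ∀ z w : U l, ρ (uMap l.incl z) (1 ⊗ₜ w) = 1 ⊗ₜ (z * w) := by
      let S : Submodule ℂ (U l) :=
        { carrier := {z | ∀ w : U l, ρ (uMap l.incl z) (1 ⊗ₜ w) = 1 ⊗ₜ (z * w)}
          add_mem' := fun {z z'} h h' w => by
            simp only [map_add, LinearMap.add_apply, h w, h' w, add_mul, TensorProduct.tmul_add]
          zero_mem' := fun w => by simp
          smul_mem' := fun r z h w => by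
            simp only [map_smul, LinearMap.smul_apply, h w, smul_mul_assoc,
              TensorProduct.tmul_smul] }
      have hS : S = ⊤ := submodule_eq_top_of_ι_mul_mem S (fun w => by simp) fun x z hz w => by
        rw [map_mul, map_mul, uMap_ι, Module.End.mul_apply, hz w, hρ, extAction_one_tmul]
        simp only [LieSubalgebra.coe_incl, h.pa_coe_l, h.pl_coe_l, map_zero,
          TensorProduct.zero_tmul, zero_add, mul_assoc]
      intro z
      exact (hS ▸ Submodule.mem_top : z ∈ S)
    intro z
    simp [hz z 1]
  · intro u e he he'
    have : ρ (u * ι ℂ e) (1 ⊗ₜ 1) = 0 := by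
      rw [map_mul, Module.End.mul_apply, hρ, extAction_one_tmul, he, he']
      simp
    simp only [LinearMap.comp_apply, AlgHom.toLinearMap_apply, LinearMap.applyₗ_apply_apply, this,
      map_zero]

end Factorization

/-! ### Sums of eigenspaces and additivity of weights -/

section Eigenspaces

variable {V W X : Type*} [AddCommGroup V] [Module ℂ V] [AddCommGroup W] [Module ℂ W]
  [AddCommGroup X] [Module ℂ X]

/-- The sum of the eigenspaces of `f` with eigenvalues in `S`. -/
def eig (f : Module.End ℂ V) (S : Set ℂ) : Submodule ℂ V := ⨆ μ ∈ S, f.eigenspace μ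

theorem mem_eig {f : Module.End ℂ V} {S : Set ℂ} {μ : ℂ} (hμ : μ ∈ S) {v : V}
    (hv : f v = μ • v) : v ∈ eig f S :=
  (le_biSup f.eigenspace hμ) (Module.End.mem_eigenspace_iff.2 hv)

theorem eig_le {f : Module.End ℂ V} {S : Set ℂ} {M : Submodule ℂ V}
    (h : ∀ μ ∈ S, ∀ v, f v = μ • v → v ∈ M) : eig f S ≤ M :=
  iSup₂_le fun μ hμ v hv => h μ hμ v (Module.End.mem_eigenspace_iff.1 hv)

theorem eig_mono (f : Module.End ℂ V) {S T : Set ℂ} (h : S ⊆ T) : eig f S ≤ eig f T :=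
  eig_le fun _ hμ _ hv => mem_eig (h hμ) hv

theorem eig_disjoint (f : Module.End ℂ V) {S T : Set ℂ} (h : Disjoint S T) :
    Disjoint (eig f S) (eig f T) :=
  f.eigenspaces_iSupIndep.disjoint_biSup_biSup h

theorem eig_map {f : Module.End ℂ V} {f' : Module.End ℂ W} (φ : V →ₗ[ℂ] W)
    (hφ : ∀ v, φ (f v) = f' (φ v)) {S : Set ℂ} {v : V} (hv : v ∈ eig f S) : φ v ∈ eig f' S := by
  suffices eig f S ≤ (eig f' S).comap φ from this hv
  exact eig_le fun μ hμ v hv => mem_eig hμ (by rw [← hφ, hv, map_smul])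

/-- Weights add under a bilinear map satisfying the Leibniz rule. Both the Lie bracket and the
product of an associative algebra are instances. -/
theorem eig_bilinear {f : Module.End ℂ V} {f' : Module.End ℂ W} {f'' : Module.End ℂ X}
    (B : V →ₗ[ℂ] W →ₗ[ℂ] X) (hB : ∀ v w, f'' (B v w) = B (f v) w + B v (f' w))
    {S T R : Set ℂ} (h : ∀ s ∈ S, ∀ t ∈ T, s + t ∈ R) {v : V} (hv : v ∈ eig f S) {w : W}
    (hw : w ∈ eig f' T) : B v w ∈ eig f'' R := by
  suffices eig f S ≤ (eig f'' R).comap (B.flip w) from this hv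
  refine eig_le fun s hs v hv => ?_
  suffices eig f' T ≤ (eig f'' R).comap (B v) from this hw
  refine eig_le fun t ht w hw => ?_
  exact mem_eig (h s hs t ht) (by rw [hB, hv, hw]; simp [add_smul])

/-- The complex numbers with negative real part. -/
abbrev reNeg : Set ℂ := {μ | μ.re < 0}

/-- The complex numbers with positive real part. -/
abbrev rePos : Set ℂ := {μ | 0 < μ.re}

end Eigenspaces

section Adjoint

variable {A : Type*} [Ring A] [Algebra ℂ A]

/-- The inner derivation `x ↦ c x - x c` of an associative algebra. -/
def innerDer (c : A) : Module.End ℂ A := LinearMap.mulLeft ℂ c - LinearMap.mulRight ℂ c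

theorem innerDer_apply (c x : A) : innerDer c x = c * x - x * c := rfl

theorem eig_mul {c : A} {S T R : Set ℂ} (h : ∀ s ∈ S, ∀ t ∈ T, s + t ∈ R) {x y : A}
    (hx : x ∈ eig (innerDer c) S) (hy : y ∈ eig (innerDer c) T) :
    x * y ∈ eig (innerDer c) R :=
  eig_bilinear (LinearMap.mul ℂ A) (fun v w => by
    simp only [LinearMap.mul_apply', innerDer_apply]; noncomm_ring) h hx hy

theorem slot_mul_tprod {k : ℕ} (j : Fin k) (a : A) (x : Fin k → A) :
    slot j a * PiTensorProduct.tprod ℂ x =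
      PiTensorProduct.tprod ℂ (Function.update x j (a * x j)) := by
  rw [PiTensorProduct.singleAlgHom_apply, PiTensorProduct.tprod_mul_tprod]
  congr 1
  funext m
  rcases eq_or_ne m j with rfl | hm
  · simp
  · simp [hm]

theorem tprod_mul_slot {k : ℕ} (j : Fin k) (a : A) (x : Fin k → A) :
    PiTensorProduct.tprod ℂ x * slot j a =
      PiTensorProduct.tprod ℂ (Function.update x j (x j * a)) := by
  rw [PiTensorProduct.singleAlgHom_apply, PiTensorProduct.tprod_mul_tprod]
  congr 1
  funext m
  rcases eq_or_ne m j with rfl | hm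
  · simp
  · simp [hm]

theorem innerDer_sum_slot_tprod {k : ℕ} {c : A} {x : Fin k → A} {μ : Fin k → ℂ}
    (h : ∀ j, innerDer c (x j) = μ j • x j) :
    innerDer (∑ j, slot j c) (PiTensorProduct.tprod ℂ x) =
      (∑ j, μ j) • PiTensorProduct.tprod ℂ x := by
  rw [innerDer_apply, Finset.sum_mul, Finset.mul_sum, ← Finset.sum_sub_distrib, Finset.sum_smul]
  refine Finset.sum_congr rfl fun j _ => ?_
  rw [slot_mul_tprod, tprod_mul_slot, ← MultilinearMap.map_update_sub, ← innerDer_apply, h,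
    MultilinearMap.map_update_smul, Function.update_eq_self]

end Adjoint

/-! ### Triangular decompositions: uniqueness of the component in `(U l)^{⊗ k}` -/

section Triangular

attribute [local instance 100] LieRing.ofAssociativeRing

open UniversalEnvelopingAlgebra (ι)

variable {L : Type*} [LieRing L] [LieAlgebra ℂ L]

/-- `L = n⁻ ⊕ l ⊕ n`, where `n⁻`, `l`, `n` consist of eigenvectors of `ad c` whose eigenvalues have
negative real part, are zero, and have positive real part. -/
structure IsTriangular (c : L) (l : LieSubalgebra ℂ L) (n : Submodule ℂ L) : Prop where
  sup_eq_top : eig (LieAlgebra.ad ℂ L c) reNeg ⊔ (l.toSubmodule ⊔ n) = ⊤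
  lie_eq_zero : ∀ z ∈ l, ⁅c, z⁆ = 0
  le_eig : n ≤ eig (LieAlgebra.ad ℂ L c) rePos

theorem eig_lie {c : L} {S T R : Set ℂ} (h : ∀ s ∈ S, ∀ t ∈ T, s + t ∈ R) {x y : L}
    (hx : x ∈ eig (LieAlgebra.ad ℂ L c) S) (hy : y ∈ eig (LieAlgebra.ad ℂ L c) T) :
    ⁅x, y⁆ ∈ eig (LieAlgebra.ad ℂ L c) R :=
  eig_bilinear (LieAlgebra.ad ℂ L).toLinearMap (fun v w => by simp) h hx hy

namespace IsTriangular

variable {c : L} {l : LieSubalgebra ℂ L} {n : Submodule ℂ L} (h : IsTriangular c l n)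
include h

theorem l_le_eig : l.toSubmodule ≤ eig (LieAlgebra.ad ℂ L c) {0} := fun z hz =>
  mem_eig (Set.mem_singleton 0) (by simpa using h.lie_eq_zero z hz)

/-- The three pieces span and weights are independent, so the `n⁻ ⊕ l` part of a vector of positive
weight has both positive and nonpositive weight, hence vanishes. The closure properties of `n` under
brackets then reduce to addition of weights. -/
theorem eq_eig : n = eig (LieAlgebra.ad ℂ L c) rePos := by
  refine le_antisymm h.le_eig fun x hx => ?_
  obtain ⟨y, hy, q, hq, rfl⟩ := Submodule.mem_sup.1 (h.sup_eq_top ▸ Submodule.mem_top : x ∈ _)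
  obtain ⟨z, hz, e, he, rfl⟩ := Submodule.mem_sup.1 hq
  have h₁ : y + z ∈ eig (LieAlgebra.ad ℂ L c) rePos := by
    have := sub_mem hx (h.le_eig he)
    rwa [show y + (z + e) - e = y + z by abel] at this
  have h₂ : y + z ∈ eig (LieAlgebra.ad ℂ L c) {μ | μ.re ≤ 0} :=
    add_mem (eig_mono _ (fun μ (h : μ.re < 0) => h.le) hy)
      (eig_mono _ (by simp) (h.l_le_eig hz))
  have h₃ := Submodule.disjoint_def.1 (eig_disjoint (LieAlgebra.ad ℂ L c)
    (Set.disjoint_left.2 fun μ (h : 0 < μ.re) h' => not_le.2 h h')) _ h₁ h₂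
  rw [← add_assoc, h₃, zero_add]
  exact he

theorem lie_mem_left {z : L} (hz : z ∈ l) {e : L} (he : e ∈ n) : ⁅z, e⁆ ∈ n := by
  rw [h.eq_eig] at he ⊢
  exact eig_lie (by simp) (h.l_le_eig hz) he

theorem lie_mem_right {z : L} (hz : z ∈ l) {e : L} (he : e ∈ n) : ⁅e, z⁆ ∈ n := by
  rw [← lie_skew]; exact n.neg_mem (h.lie_mem_left hz he)

theorem lie_mem_n {e e' : L} (he : e ∈ n) (he' : e' ∈ n) : ⁅e, e'⁆ ∈ n := by
  rw [h.eq_eig] at he he' ⊢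
  exact eig_lie (fun s hs t ht => by
    simp only [Set.mem_ofPred_eq, Complex.add_re] at *; linarith) he he'

theorem lie_c_mem {e : L} (he : e ∈ n) : ⁅c, e⁆ ∈ n := by
  rw [h.eq_eig] at he ⊢
  exact eig_lie (S := {0}) (by simp)
    (mem_eig (Set.mem_singleton 0) (by simp)) he

/-- Here `a` is the part of negative weight, `pa` projects along `l ⊕ n`, and `pl` along `a ⊕ n`.
The bracket conditions hold because `n` is an ideal of `l ⊕ n`. -/
theorem exists_isFactorization : ∃ (a : LieSubalgebra ℂ L) (pa : L →ₗ[ℂ] a) (pl : L →ₗ[ℂ] l),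
    IsFactorization pa pl ∧ ∀ e ∈ n, pa e = 0 ∧ pl e = 0 := by
  let a : LieSubalgebra ℂ L :=
    { eig (LieAlgebra.ad ℂ L c) reNeg with
      lie_mem' := fun hx hy => eig_lie (fun s hs t ht => by
        simp only [Set.mem_ofPred_eq, Complex.add_re] at *; linarith) hx hy }
  have hl : l.toSubmodule ≤ eig (LieAlgebra.ad ℂ L c) {0} := h.l_le_eig
  have ha : IsCompl a.toSubmodule (l.toSubmodule ⊔ n) := by
    refine ⟨?_, codisjoint_iff.2 h.sup_eq_top⟩
    refine (eig_disjoint (LieAlgebra.ad ℂ L c) (S := reNeg) (T := {μ | 0 ≤ μ.re})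
      (Set.disjoint_left.2 fun μ (h : μ.re < 0) h' => not_le.2 h h')).mono_right ?_
    exact sup_le (hl.trans (eig_mono _ (by simp)))
      (h.le_eig.trans (eig_mono _ fun μ (h : 0 < μ.re) => h.le))
  have hc : IsCompl l.toSubmodule (a.toSubmodule ⊔ n) := by
    refine ⟨?_, codisjoint_iff.2 ?_⟩
    · refine (eig_disjoint (LieAlgebra.ad ℂ L c) (S := {0}) (T := {μ | μ.re ≠ 0})
        (by simp)).mono hl (sup_le (eig_mono _ ?_) (h.le_eig.trans (eig_mono _ ?_)))
      · exact fun μ (h : μ.re < 0) => h.ne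
      · exact fun μ (h : 0 < μ.re) => h.ne'
    · rw [← h.sup_eq_top, sup_left_comm]
  have hq : ∀ x, a.toSubmodule.projectionOnto _ ha x = 0 → ∃ z : l, ∃ e ∈ n, x = z + e := by
    intro x hx
    obtain ⟨z, hz, e, he, rfl⟩ :=
      Submodule.mem_sup.1 ((Submodule.projectionOnto_apply_eq_zero_iff ha).1 hx)
    exact ⟨⟨z, hz⟩, e, he, rfl⟩
  have ha₀ : ∀ (z : l), ∀ e ∈ n, a.toSubmodule.projectionOnto _ ha (z + e) = 0 := fun z e he =>
    (Submodule.projectionOnto_apply_eq_zero_iff ha).2 (Submodule.add_mem_sup z.2 he)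
  have hc₀ : ∀ (z : l), ∀ e ∈ n, l.toSubmodule.projectionOnto _ hc (z + e) = z := fun z e he => by
    have : l.toSubmodule.projectionOnto _ hc z = z := Submodule.projectionOnto_apply_left hc z
    rw [map_add, this, (Submodule.projectionOnto_apply_eq_zero_iff hc).2
      (Submodule.mem_sup_right he), add_zero]
  have hlie : ∀ (z z' : l), ∀ e ∈ n, ∀ e' ∈ n, ∃ e'' ∈ n,
      ⁅(z : L) + e, (z' : L) + e'⁆ = (⁅z, z'⁆ : l) + e'' := fun z z' e he e' he' =>
    ⟨⁅(z : L), e'⁆ + ⁅e, (z' : L)⁆ + ⁅e, e'⁆, n.add_mem (n.add_mem (h.lie_mem_left z.2 he')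
      (h.lie_mem_right z'.2 he)) (h.lie_mem_n he he'), by
      simp only [add_lie, lie_add, LieSubalgebra.coe_bracket]; abel⟩
  refine ⟨a, a.toSubmodule.projectionOnto _ ha, l.toSubmodule.projectionOnto _ hc,
    ⟨fun y => ?_, fun y => ?_, fun z => ?_, fun z => ?_, ?_, ?_⟩, fun e he => ⟨?_, ?_⟩⟩
  · exact Submodule.projectionOnto_apply_left ha y
  · exact (Submodule.projectionOnto_apply_eq_zero_iff hc).2 (Submodule.mem_sup_left y.2)
  · exact (Submodule.projectionOnto_apply_eq_zero_iff ha).2 (Submodule.mem_sup_left z.2)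
  · exact Submodule.projectionOnto_apply_left hc z
  · intro x x' hx hx'
    obtain ⟨z, e, he, rfl⟩ := hq x hx
    obtain ⟨z', e', he', rfl⟩ := hq x' hx'
    obtain ⟨e'', he'', h''⟩ := hlie z z' e he e' he'
    rw [h'', ha₀ _ _ he'']
  · intro x x' hx hx'
    obtain ⟨z, e, he, rfl⟩ := hq x hx
    obtain ⟨z', e', he', rfl⟩ := hq x' hx'
    obtain ⟨e'', he'', h''⟩ := hlie z z' e he e' he'
    rw [h'', hc₀ _ _ he'', hc₀ _ _ he, hc₀ _ _ he']
  · exact (Submodule.projectionOnto_apply_eq_zero_iff ha).2 (Submodule.mem_sup_right he)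
  · exact (Submodule.projectionOnto_apply_eq_zero_iff hc).2 (Submodule.mem_sup_right he)

/-- `(U l)^{⊗ k}` meets the left ideal generated by `n` trivially. -/
theorem tpowMap_mem_slotIdeal {k : ℕ} {z : TPow k (U l)}
    (hz : tpowMap k (uMap l.incl) z ∈ slotIdeal n k) : z = 0 := by
  obtain ⟨a, pa, pl, hf, hn⟩ := h.exists_isFactorization
  obtain ⟨P, hP, hP'⟩ := hf.exists_retraction
  let Q : TPow k (U L) →ₗ[ℂ] TPow k (U l) := PiTensorProduct.map fun _ => P
  have h₁ : ∀ z, Q (tpowMap k (uMap l.incl) z) = z := by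
    intro z
    suffices Q ∘ₗ tpowMap k (uMap l.incl) = LinearMap.id from DFunLike.congr_fun this z
    apply PiTensorProduct.ext
    ext x
    simp [Q, tpowMap, hP]
  -- `K` is the largest left ideal inside the kernel of `Q`. It contains the generators of
  -- `slotIdeal n k`, since `Q` acts slot by slot and `P` vanishes on `(U L) n`.
  let K : Ideal (TPow k (U L)) :=
    { carrier := {y | ∀ u, Q (u * y) = 0}
      add_mem' := fun {y y'} hy hy' u => by rw [mul_add, map_add, hy u, hy' u, add_zero]
      zero_mem' := fun u => by rw [mul_zero, map_zero]
      smul_mem' := fun r y hy u => by rw [smul_eq_mul, ← mul_assoc]; exact hy _ }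
  have h₂ : slotIdeal n k ≤ K := by
    rw [slotIdeal, Ideal.span_le]
    rintro _ ⟨j, e, he, rfl⟩ u
    induction u using PiTensorProduct.induction_on with
    | smul_tprod r x =>
      rw [smul_mul_assoc, map_smul, tprod_mul_slot, PiTensorProduct.map_tprod,
        MultilinearMap.map_coord_zero _ j, smul_zero]
      rw [Function.update_self]
      exact hP' _ e (hn e he).1 (hn e he).2
    | add x y hx hy => rw [add_mul, map_add, hx, hy, add_zero]
  rw [← h₁ z, ← one_mul (tpowMap k (uMap l.incl) z)]
  exact h₂ hz 1

end IsTriangular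

end Triangular

/-! ### Triangular decompositions: existence of the component in `(U l)^{⊗ k}` -/

section Triangular

attribute [local instance 100] LieRing.ofAssociativeRing

open UniversalEnvelopingAlgebra (ι)

variable {L : Type*} [LieRing L] [LieAlgebra ℂ L]

/-- The left ideal of `U L` generated by a subspace of `L`. -/
def leftIdeal (n : Submodule ℂ L) : Ideal (U L) := Ideal.span (ι ℂ '' n)

theorem ι_mem_leftIdeal {n : Submodule ℂ L} {e : L} (he : e ∈ n) : ι ℂ e ∈ leftIdeal n :=
  Ideal.subset_span ⟨e, he, rfl⟩

theorem ι_mul_ι (x y : L) : ι ℂ x * ι ℂ y = ι ℂ y * ι ℂ x + ι ℂ ⁅x, y⁆ := by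
  rw [LieHom.map_lie, LieRing.of_associative_ring_bracket]; abel

theorem innerDer_ι (c x : L) : innerDer (ι ℂ c) (ι ℂ x) = ι ℂ ⁅c, x⁆ := by
  rw [LieHom.map_lie, LieRing.of_associative_ring_bracket, innerDer_apply]

/-- The products `y₁ ⋯ y_r z` with `y_i ∈ L` of negative weight and `z ∈ U l`. -/
def negWords (c : L) (l : LieSubalgebra ℂ L) : Submodule ℂ (U L) :=
  Submodule.span ℂ {v | ∃ ys : List L, (∀ y ∈ ys, y ∈ eig (LieAlgebra.ad ℂ L c) reNeg) ∧
    ∃ z : U l, v = (ys.map (ι ℂ)).prod * uMap l.incl z}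

theorem innerDer_uMap_eq_zero {l : LieSubalgebra ℂ L} {d : L} (hd : ∀ z ∈ l, ⁅d, z⁆ = 0)
    (z : U l) : innerDer (ι ℂ d) (uMap l.incl z) = 0 := by
  let S : Subalgebra ℂ (U l) :=
    { carrier := {z | Commute (ι ℂ d) (uMap l.incl z)}
      mul_mem' := fun {z w} hz hw => by
        change Commute _ _; rw [map_mul]; exact Commute.mul_right hz hw
      add_mem' := fun {z w} hz hw => by
        change Commute _ _; rw [map_add]; exact Commute.add_right hz hw
      algebraMap_mem' := fun r => by
        change Commute _ _; rw [AlgHom.commutes]; exact Algebra.commute_algebraMap_right _ _ }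
  have hS : S = ⊤ := subalgebra_eq_top_of_ι_mem S fun x => by
    change Commute _ _
    rw [uMap_ι, Commute, SemiconjBy, ι_mul_ι, LieSubalgebra.coe_incl, hd _ x.2, map_zero, add_zero]
  exact sub_eq_zero.2 (show Commute (ι ℂ d) (uMap l.incl z) from
    (hS ▸ Algebra.mem_top : z ∈ S)).eq

theorem innerDer_tpowMap_eq_zero {l : LieSubalgebra ℂ L} {k : ℕ} {d : L}
    (hd : ∀ z ∈ l, ⁅d, z⁆ = 0) (z : TPow k (U l)) :
    innerDer (diag k d) (tpowMap k (uMap l.incl) z) = 0 := by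
  induction z using PiTensorProduct.induction_on with
  | smul_tprod r x =>
    rw [map_smul, map_smul, tpowMap, PiTensorProduct.map_tprod, diag,
      innerDer_sum_slot_tprod (μ := 0)]
    · simp
    · intro j
      rw [Pi.zero_apply, zero_smul]
      exact innerDer_uMap_eq_zero hd (x j)
  | add x y hx hy => rw [map_add, map_add, hx, hy, add_zero]

namespace IsTriangular

variable {c : L} {l : LieSubalgebra ℂ L} {n : Submodule ℂ L} (h : IsTriangular c l n)
include h

/-- Since `[n, l] ⊆ n`, a factor from `l` can be moved to the left of one from `n` at the cost of
another element of `n`. -/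
theorem leftIdeal_mul_uMap {u : U L} (hu : u ∈ leftIdeal n) (z : U l) :
    u * uMap l.incl z ∈ leftIdeal n := by
  let S : Subalgebra ℂ (U l) :=
    { carrier := {z | ∀ u ∈ leftIdeal n, u * uMap l.incl z ∈ leftIdeal n}
      mul_mem' := fun {z w} hz hw u hu => by
        rw [map_mul, ← mul_assoc]; exact hw _ (hz _ hu)
      add_mem' := fun {z w} hz hw u hu => by
        rw [map_add, mul_add]; exact add_mem (hz _ hu) (hw _ hu)
      algebraMap_mem' := fun r u hu => by
        rw [AlgHom.commutes, ← Algebra.commutes]; exact (leftIdeal n).mul_mem_left _ hu }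
  have hS : S = ⊤ := subalgebra_eq_top_of_ι_mem S fun x u hu => by
    suffices leftIdeal n ≤ Submodule.comap (LinearMap.toSpanSingleton (U L) (U L)
      (uMap l.incl (ι ℂ x))) (leftIdeal n) from this hu
    refine Ideal.span_le.2 ?_
    rintro _ ⟨e, he, rfl⟩
    change ι ℂ e * uMap l.incl (ι ℂ x) ∈ leftIdeal n
    rw [uMap_ι, ι_mul_ι]
    exact add_mem ((leftIdeal n).mul_mem_left _ (ι_mem_leftIdeal he))
      (ι_mem_leftIdeal (h.lie_mem_right x.2 he))
  exact (hS ▸ Algebra.mem_top : z ∈ S) u hu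

theorem negWords_sup_leftIdeal :
    negWords c l ⊔ (leftIdeal n).restrictScalars ℂ = ⊤ := by
  have hneg : ∀ y ∈ eig (LieAlgebra.ad ℂ L c) reNeg,
      ∀ u ∈ negWords c l ⊔ (leftIdeal n).restrictScalars ℂ,
        ι ℂ y * u ∈ negWords c l ⊔ (leftIdeal n).restrictScalars ℂ := by
    intro y hy u hu
    obtain ⟨w, hw, j, hj, rfl⟩ := Submodule.mem_sup.1 hu
    rw [mul_add]
    refine Submodule.add_mem_sup ?_ ((leftIdeal n).mul_mem_left _ hj)
    suffices negWords c l ≤ (negWords c l).comap (LinearMap.mulLeft ℂ (ι ℂ y)) from this hw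
    refine Submodule.span_le.2 ?_
    rintro _ ⟨ys, hys, z, rfl⟩
    refine Submodule.subset_span ⟨y :: ys, ?_, z, ?_⟩
    · simpa [hy] using hys
    · simp [mul_assoc]
  -- Straightening by induction on word length, with `x` an arbitrary element of `L`: in `x y w = y
  -- x w + [x, y] w` both `x w` and `[x, y] w` involve the shorter word `w`.
  have hword : ∀ (ys : List L), (∀ y ∈ ys, y ∈ eig (LieAlgebra.ad ℂ L c) reNeg) →
      ∀ (z : U l) (x : L), ι ℂ x * ((ys.map (ι ℂ)).prod * uMap l.incl z) ∈
        negWords c l ⊔ (leftIdeal n).restrictScalars ℂ := by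
    intro ys
    induction ys with
    | nil =>
      intro _ z x
      obtain ⟨y, hy, q, hq, rfl⟩ := Submodule.mem_sup.1 (h.sup_eq_top ▸ Submodule.mem_top : x ∈ _)
      obtain ⟨w, hw, e, he, rfl⟩ := Submodule.mem_sup.1 hq
      rw [List.map_nil, List.prod_nil, one_mul, map_add, map_add, add_mul, add_mul]
      refine add_mem (Submodule.mem_sup_left (Submodule.subset_span ⟨[y], by simpa, z, by simp⟩))
        (Submodule.add_mem_sup (Submodule.subset_span
          ⟨[], by simp, ι ℂ (⟨w, hw⟩ : l) * z, ?_⟩) ?_)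
      · rw [map_mul, uMap_ι]; simp
      · exact h.leftIdeal_mul_uMap (ι_mem_leftIdeal he) z
    | cons y ys ih =>
      intro hys z x
      have hy := hys y List.mem_cons_self
      have ih' := ih (fun y hy => hys y (List.mem_cons_of_mem _ hy)) z
      rw [List.map_cons, List.prod_cons, mul_assoc, ← mul_assoc, ι_mul_ι, add_mul, mul_assoc]
      exact add_mem (hneg y hy _ (ih' x)) (ih' _)
  refine submodule_eq_top_of_ι_mul_mem _ ?_ fun x u hu => ?_
  · exact Submodule.mem_sup_left (Submodule.subset_span ⟨[], by simp, 1, by simp⟩)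
  · obtain ⟨w, hw, j, hj, rfl⟩ := Submodule.mem_sup.1 hu
    rw [mul_add]
    refine add_mem ?_ (Submodule.mem_sup_right ((leftIdeal n).mul_mem_left _ hj))
    suffices negWords c l ≤ (negWords c l ⊔ (leftIdeal n).restrictScalars ℂ).comap
      (LinearMap.mulLeft ℂ (ι ℂ x)) from this hw
    refine Submodule.span_le.2 ?_
    rintro _ ⟨ys, hys, z, rfl⟩
    exact hword ys hys z x

theorem innerDer_uMap (z : U l) : innerDer (ι ℂ c) (uMap l.incl z) = 0 :=
  innerDer_uMap_eq_zero h.lie_eq_zero z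

/-- A word with at least one letter from `n⁻` has negative weight, as `U l` has weight zero; the
empty word leaves `U l`. -/
theorem negWords_le : negWords c l ≤
    LinearMap.range (uMap l.incl).toLinearMap ⊔ eig (innerDer (ι ℂ c)) reNeg := by
  have hneg : ∀ y ∈ eig (LieAlgebra.ad ℂ L c) reNeg, ι ℂ y ∈ eig (innerDer (ι ℂ c)) reNeg :=
    fun y hy => eig_map (ι ℂ : L →ₗ⁅ℂ⁆ U L).toLinearMap (fun v => (innerDer_ι c v).symm) hy
  have hnonpos : ∀ ys : List L, (∀ y ∈ ys, y ∈ eig (LieAlgebra.ad ℂ L c) reNeg) → ∀ z : U l,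
      (ys.map (ι ℂ)).prod * uMap l.incl z ∈ eig (innerDer (ι ℂ c)) {μ | μ.re ≤ 0} := by
    intro ys hys z
    induction ys with
    | nil => exact mem_eig (μ := 0) (by simp) (by simpa using h.innerDer_uMap z)
    | cons y ys ih =>
      rw [List.map_cons, List.prod_cons, mul_assoc]
      refine eig_mul (S := reNeg) (fun s hs t ht => ?_) (hneg y (hys y List.mem_cons_self))
        (ih fun y hy => hys y (List.mem_cons_of_mem _ hy))
      simp only [Set.mem_ofPred_eq, Complex.add_re] at *; linarith
  refine Submodule.span_le.2 ?_
  rintro _ ⟨ys, hys, z, rfl⟩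
  cases ys with
  | nil => exact Submodule.mem_sup_left ⟨z, by simp⟩
  | cons y ys =>
    refine Submodule.mem_sup_right ?_
    rw [List.map_cons, List.prod_cons, mul_assoc]
    refine eig_mul (S := reNeg) (T := {μ | μ.re ≤ 0}) (fun s hs t ht => ?_)
      (hneg y (hys y List.mem_cons_self))
      (hnonpos ys (fun y hy => hys y (List.mem_cons_of_mem _ hy)) z)
    simp only [Set.mem_ofPred_eq, Complex.add_re] at *; linarith

/-- `U L` is spanned by the left ideal generated by `n`, by `U l`, and by the elements of negative
weight. -/
theorem span_eq_top : Submodule.span ℂ {u : U L | u ∈ leftIdeal n ∨ (∃ z : U l, uMap l.incl z = u) ∨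
    ∃ μ ∈ reNeg, innerDer (ι ℂ c) u = μ • u} = ⊤ := by
  rw [eq_top_iff, ← h.negWords_sup_leftIdeal]
  refine sup_le (h.negWords_le.trans (sup_le ?_ ?_)) ?_
  · rintro _ ⟨z, rfl⟩
    exact Submodule.subset_span (Or.inr (Or.inl ⟨z, rfl⟩))
  · exact eig_le fun μ hμ v hv => Submodule.subset_span (Or.inr (Or.inr ⟨μ, hμ, hv⟩))
  · exact fun u hu => Submodule.subset_span (Or.inl hu)

omit h in
theorem slot_mem_slotIdeal_of_mem_leftIdeal {k : ℕ} (j : Fin k) {u : U L}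
    (hu : u ∈ leftIdeal n) : slot j u ∈ slotIdeal n k := by
  suffices leftIdeal n ≤ (slotIdeal n k).comap (slot j : U L →ₐ[ℂ] TPow k (U L)) from this hu
  refine Ideal.span_le.2 ?_
  rintro _ ⟨e, he, rfl⟩
  exact slot_mem_slotIdeal j he

/-- Take pure tensors whose entries are of the three kinds in `span_eq_top`. An entry in the left
ideal puts the tensor in `slotIdeal`; if all entries come from `U l`, so does the tensor; otherwise
the weights add to one with negative real part. -/
theorem tpow_eq_top (k : ℕ) : (slotIdeal n k).restrictScalars ℂ ⊔
    (LinearMap.range (tpowMap k (uMap l.incl)) ⊔ eig (innerDer (diag k c)) reNeg) = ⊤ := by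
  have := PiTensorProduct.submodule_span_eq_top (R := ℂ) (M := fun _ : Fin k => U L)
    (g := fun _ (u : {u : U L | u ∈ leftIdeal n ∨ (∃ z : U l, uMap l.incl z = u) ∨
      ∃ μ ∈ reNeg, innerDer (ι ℂ c) u = μ • u}) => (u : U L))
    (fun _ => by rw [Subtype.range_coe]; exact h.span_eq_top)
  rw [eq_top_iff, ← this]
  refine Submodule.span_le.2 ?_
  rintro _ ⟨x, rfl⟩
  beta_reduce
  by_cases h₁ : ∃ j, (x j : U L) ∈ leftIdeal n
  · obtain ⟨j, hj⟩ := h₁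
    refine Submodule.mem_sup_left ?_
    have : PiTensorProduct.tprod ℂ (fun j => (x j : U L)) =
        PiTensorProduct.tprod ℂ (Function.update (fun j => (x j : U L)) j 1) *
          slot j (x j : U L) := by
      rw [tprod_mul_slot]; simp
    rw [this]
    exact (slotIdeal n k).mul_mem_left _ (slot_mem_slotIdeal_of_mem_leftIdeal j hj)
  · refine Submodule.mem_sup_right ?_
    have h₂ : ∀ j, (∃ z : U l, uMap l.incl z = x j) ∨
        ∃ μ ∈ reNeg, innerDer (ι ℂ c) (x j : U L) = μ • (x j : U L) := fun j =>
      (x j).2.resolve_left fun hj => h₁ ⟨j, hj⟩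
    by_cases h₃ : ∀ j, ∃ z : U l, uMap l.incl z = x j
    · choose z hz using h₃
      refine Submodule.mem_sup_left ⟨PiTensorProduct.tprod ℂ z, ?_⟩
      simp [tpowMap, hz]
    · refine Submodule.mem_sup_right ?_
      push Not at h₃
      obtain ⟨j₀, hj₀⟩ := h₃
      have h₄ : ∀ j, ∃ μ : ℂ, μ.re ≤ 0 ∧ (j = j₀ → μ.re < 0) ∧
          innerDer (ι ℂ c) (x j : U L) = μ • (x j : U L) := by
        intro j
        rcases h₂ j with ⟨z, hz⟩ | ⟨μ, hμ, hj⟩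
        · refine ⟨0, le_rfl, ?_, by rw [← hz, h.innerDer_uMap, zero_smul]⟩
          rintro rfl
          exact absurd hz (hj₀ z)
        · exact ⟨μ, le_of_lt hμ, fun _ => hμ, hj⟩
      choose μ hμ hμ' hx using h₄
      refine mem_eig (μ := ∑ j, μ j) ?_ (innerDer_sum_slot_tprod hx)
      change (∑ j, μ j).re < 0
      rw [Complex.re_sum]
      exact Finset.sum_neg' (fun j _ => hμ j) ⟨j₀, Finset.mem_univ _, hμ' j₀ rfl⟩

/-- The issue is right multiplication by `diag k c`, which preserves the left ideal because `[c, n]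
⊆ n`. It lets the derivation act on the quotient. -/
theorem innerDer_mem_slotIdeal {k : ℕ} {x : TPow k (U L)} (hx : x ∈ slotIdeal n k) :
    innerDer (diag k c) x ∈ slotIdeal n k := by
  rw [innerDer_apply]
  refine sub_mem ((slotIdeal n k).mul_mem_left _ hx) ?_
  suffices slotIdeal n k ≤ Submodule.comap (LinearMap.toSpanSingleton (TPow k (U L))
    (TPow k (U L)) (diag k c)) (slotIdeal n k) from this hx
  rw [slotIdeal, Ideal.span_le]
  rintro _ ⟨j, e, he, rfl⟩
  change slot j (ι ℂ e) * diag k c ∈ slotIdeal n k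
  rw [diag, Finset.mul_sum]
  refine sum_mem fun i _ => ?_
  rcases eq_or_ne j i with rfl | hij
  · rw [← map_mul, ι_mul_ι, map_add, map_mul]
    refine add_mem ((slotIdeal n k).mul_mem_left _ (slot_mem_slotIdeal _ he))
      (slot_mem_slotIdeal _ ?_)
    rw [← lie_skew]
    exact n.neg_mem (h.lie_c_mem he)
  · rw [(slot_commute hij _ _).eq]
    exact (slotIdeal n k).mul_mem_left _ (slot_mem_slotIdeal _ he)

/-- Every `c`-invariant of `(U L)^{⊗ k}` is congruent to an element of `(U l)^{⊗ k}` modulo the left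
ideal generated by `n`. -/
theorem exists_sub_mem_slotIdeal {k : ℕ} {x : TPow k (U L)} (hx : innerDer (diag k c) x = 0) :
    ∃ z, x - tpowMap k (uMap l.incl) z ∈ slotIdeal n k := by
  obtain ⟨j, hj, y, hy, rfl⟩ := Submodule.mem_sup.1 (h.tpow_eq_top k ▸ Submodule.mem_top : x ∈ _)
  obtain ⟨_, ⟨z, rfl⟩, w, hw, rfl⟩ := Submodule.mem_sup.1 hy
  refine ⟨z, ?_⟩
  have hz : innerDer (diag k c) (tpowMap k (uMap l.incl) z) = 0 :=
    innerDer_tpowMap_eq_zero h.lie_eq_zero z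
  let J := (slotIdeal n k).restrictScalars ℂ
  -- In the quotient by `J` the class of `w` has negative weight. It also has weight zero, since `x`
  -- and the image of `z` are killed by the derivation and `j ∈ J`. So `w ∈ J`.
  have hJ : J ≤ J.comap (innerDer (diag k c)) := fun _ hx => h.innerDer_mem_slotIdeal hx
  have hw₁ : J.mkQ w ∈ eig (J.mapQ J (innerDer (diag k c)) hJ) reNeg :=
    eig_map J.mkQ (fun _ => rfl) hw
  have hw₂ : J.mkQ w ∈ eig (J.mapQ J (innerDer (diag k c)) hJ) {0} := by
    refine mem_eig (Set.mem_singleton 0) ?_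
    rw [zero_smul, Submodule.mkQ_apply, Submodule.mapQ_apply, Submodule.Quotient.mk_eq_zero]
    rw [map_add, map_add, hz, zero_add, add_comm] at hx
    rw [eq_neg_of_add_eq_zero_left hx]
    exact J.neg_mem (hJ hj)
  have hw₃ := Submodule.disjoint_def.1 (eig_disjoint _ (by simp)) _ hw₁ hw₂
  rw [Submodule.mkQ_apply, Submodule.Quotient.mk_eq_zero] at hw₃
  rw [show j + (tpowMap k (uMap l.incl) z + w) - tpowMap k (uMap l.incl) z = j + w by abel]
  exact J.add_mem hj hw₃

end IsTriangular

end Triangular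

/-! ### The grading element, the Levi subalgebra and its projection -/

section Levi

open LieAlgebra LieModule IsKilling

variable {g : Type*} [LieRing g] [LieAlgebra ℂ g] [FiniteDimensional ℂ g]
variable {H : LieSubalgebra ℂ g} [H.IsCartanSubalgebra]

variable {D : Finset H.root}

theorem rootSpace_le_diagSubalgebra {α : H.root} (hα : α ∈ D) :
    (rootSpace H (α.1 : H → ℂ)).toSubmodule ≤ (diagSubalgebra H D).toSubmodule := fun _ he =>
  LieSubalgebra.subset_lieSpan ⟨α, hα, Or.inl he⟩

theorem rootSpace_neg_le_diagSubalgebra {α : H.root} (hα : α ∈ D) :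
    (rootSpace H (-(α.1 : H → ℂ))).toSubmodule ≤ (diagSubalgebra H D).toSubmodule := fun _ he =>
  LieSubalgebra.subset_lieSpan ⟨α, hα, Or.inr he⟩

theorem mem_leviCentre {d : g} : d ∈ leviCentre H D ↔
    d ∈ levi H D ∧ ∀ z ∈ levi H D, ⁅d, z⁆ = 0 := by
  constructor
  · rintro ⟨hd, h⟩
    refine ⟨hd, fun z hz => ?_⟩
    rw [LieModule.mem_maxTrivSubmodule] at h
    have := congrArg Subtype.val (h ⟨z, hz⟩)
    rw [← lie_skew, neg_eq_zero]
    exact this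
  · rintro ⟨hd, h⟩
    refine ⟨hd, ?_⟩
    rw [LieModule.mem_maxTrivSubmodule]
    rintro ⟨z, hz⟩
    refine Subtype.ext ?_
    change ⁅z, d⁆ = 0
    rw [← lie_skew, neg_eq_zero]
    exact h z hz

theorem le_levi : H ≤ levi H D := le_sup_right

theorem diagSubalgebra_le_levi : diagSubalgebra H D ≤ levi H D := le_sup_left

variable [IsSemisimple ℂ g]

/-- A subalgebra containing `g_α` and `g_β` contains `g_{α + β}`. -/
theorem rootSpace_add_le {α β γ : Weight ℂ H g} (hα : α.IsNonZero) (hγ : γ.IsNonZero)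
    (h : (γ : H → ℂ) = α + β) {K : LieSubalgebra ℂ g}
    (hKα : (rootSpace H (α : H → ℂ)).toSubmodule ≤ K.toSubmodule)
    (hKβ : (rootSpace H (β : H → ℂ)).toSubmodule ≤ K.toSubmodule) :
    (rootSpace H (γ : H → ℂ)).toSubmodule ≤ K.toSubmodule := by
  have hp : 1 ≤ chainTopCoeff α β := by
    have := ((rootSpace_zsmul_add_ne_bot_iff α β hα 1).1
      (by rw [one_smul, ← h]; exact γ.genWeightSpace_ne_bot)).1
    exact_mod_cast this
  obtain ⟨q, hq⟩ : ∃ q, chainTopCoeff α β = q + 1 := ⟨_, (Nat.sub_add_cancel hp).symm⟩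
  -- With `x` at the top of the `α`-string through `β`, which lies `q + 1` steps above `β`, the
  -- vectors `f^{q+1} x` and `f^q x` have weights `β` and `γ`.
  obtain ⟨x, hx, hx₀⟩ := (chainTop α β).exists_ne_zero
  obtain ⟨t, e, f, ht, he, hf⟩ := exists_isSl2Triple_of_weight_isNonZero hα
  obtain rfl := ht.h_eq_coroot hα he hf
  have prim : ht.HasPrimitiveVectorWith x (chainLength α β : ℂ) :=
    have := lie_mem_genWeightSpace_of_mem_genWeightSpace he hx
    ⟨hx₀, (chainLength_smul _ _ hx).symm, by rwa [genWeightSpace_add_chainTop _ _ hα] at this⟩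
  have hle : q + 1 ≤ chainLength α β := hq ▸ chainTopCoeff_le_chainLength α β
  have h₀ := prim.pow_toEnd_f_ne_zero_of_eq_nat rfl (i := q) (by omega)
  have h₁ : ((toEnd ℂ g g f) ^ (q + 1)) x ∈ rootSpace H (β : H → ℂ) := by
    have := toEnd_pow_apply_mem hf hx (q + 1)
    rwa [coe_chainTop, hq, show (q + 1) • (-(α : H → ℂ)) + (((q + 1 : ℕ) : ℤ) • (α : H → ℂ) + β) =
      β by rw [natCast_zsmul]; module] at this
  have h₂ : ((toEnd ℂ g g f) ^ q) x ∈ rootSpace H (γ : H → ℂ) := by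
    have := toEnd_pow_apply_mem hf hx q
    rwa [coe_chainTop, hq, show q • (-(α : H → ℂ)) + (((q + 1 : ℕ) : ℤ) • (α : H → ℂ) + β) =
      γ by rw [natCast_zsmul, h]; module] at this
  -- By `sl₂`-theory `e f^{q+1} x = (q + 1)(N - q) f^q x`, where the length `N` of the string is at
  -- least `q + 1`, so the scalar is nonzero. As `g_γ` is a line, it lies in `K`.
  have h₃ : ((toEnd ℂ g g f) ^ q) x ∈ K := by
    have := K.lie_mem (hKα he) (hKβ h₁)
    rw [prim.lie_e_pow_succ_toEnd_f] at this
    refine (K.toSubmodule.smul_mem_iff (mul_ne_zero ?_ ?_)).1 this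
    · exact_mod_cast Nat.succ_ne_zero q
    · rw [sub_ne_zero]
      exact_mod_cast (by omega : chainLength α β ≠ q)
  intro y hy
  obtain ⟨r, hr⟩ := (finrank_eq_one_iff_of_nonzero' (⟨_, h₂⟩ : rootSpace H (γ : H → ℂ))
    (by simpa using h₀)).1 (finrank_rootSpace_eq_one γ hγ) ⟨y, hy⟩
  rw [← show r • ((toEnd ℂ g g f) ^ q) x = y from congrArg Subtype.val hr]
  exact K.toSubmodule.smul_mem r h₃

theorem lie_rootSpace {α : H → ℂ} {x : g} (hx : x ∈ rootSpace H α) (d : H) :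
    ⁅(d : g), x⁆ = α d • x := lie_eq_smul_of_mem_rootSpace hx d

/-- If the roots in `D` vanish on `d ∈ h`, then `d` commutes with `l_D`. -/
theorem lie_levi_eq_zero {d : H} (hd : ∀ α ∈ D, α.1 d = 0) : ∀ z ∈ levi H D, ⁅(d : g), z⁆ = 0 := by
  let K : LieSubalgebra ℂ g :=
    { LinearMap.ker (LieAlgebra.ad ℂ g (d : g)) with
      lie_mem' := fun {x y} hx hy => by
        have hx : ⁅(d : g), x⁆ = 0 := hx
        have hy : ⁅(d : g), y⁆ = 0 := hy
        change ⁅(d : g), ⁅x, y⁆⁆ = 0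
        rw [leibniz_lie, hx, hy, zero_lie, lie_zero, add_zero] }
  suffices levi H D ≤ K from fun z hz => this hz
  refine sup_le (LieSubalgebra.lieSpan_le.2 ?_) fun z hz => ?_
  · rintro e ⟨α, hα, he | he⟩
    · change ⁅(d : g), e⁆ = 0
      rw [lie_rootSpace he, hd α hα, zero_smul]
    · change ⁅(d : g), e⁆ = 0
      rw [lie_rootSpace he, Pi.neg_apply, hd α hα, neg_zero, zero_smul]
  · exact congrArg Subtype.val (trivial_lie_zero H H d ⟨z, hz⟩)

variable (b : (rootSystem H).Base) (D)

/-- There is a `c ∈ h` on which the simple roots take the value `0` in `D` and `1` off `D`. -/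
theorem exists_grading_element : ∃ c : H, ∀ α ∈ b.support,
    (α ∈ D → α.1 c = 0) ∧ (α ∉ D → α.1 c = 1) := by
  classical
  -- The simple roots are a basis of the dual of `h`, so the values may be prescribed; biduality
  -- turns the functional into an element of `h`.
  let v : Module.Dual ℂ (Module.Dual ℂ H) :=
    b.toWeightBasis.constr ℂ fun i => if i.1 ∈ D then 0 else 1
  refine ⟨(Module.evalEquiv ℂ H).symm v, fun α hα => ?_⟩
  have h : α.1 ((Module.evalEquiv ℂ H).symm v) = if α ∈ D then 0 else 1 := by
    have h₁ : v ((rootSystem H).root α) = if α ∈ D then 0 else 1 := by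
      have := b.toWeightBasis.constr_basis ℂ (fun i : b.support => if i.1 ∈ D then (0 : ℂ) else 1)
        ⟨α, hα⟩
      rwa [RootPairing.Base.toWeightBasis_apply] at this
    rw [← h₁, ← Module.apply_evalEquiv_symm_apply]
    rfl
  rw [h]
  exact ⟨fun h => if_pos h, fun h => if_neg h⟩

variable {b D}

/-- The values of the positive roots at a grading element are natural numbers, and the roots that
vanish are roots of `g_D`. -/
theorem pos_root_apply {c : H} (hc : ∀ α ∈ b.support, (α ∈ D → α.1 c = 0) ∧ (α ∉ D → α.1 c = 1))
    {α : H.root} (hα : b.IsPos α) : ∃ m : ℕ, α.1 c = m ∧ (m = 0 →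
      (rootSpace H (α.1 : H → ℂ)).toSubmodule ≤ (diagSubalgebra H D).toSubmodule ∧
      (rootSpace H (-(α.1 : H → ℂ))).toSubmodule ≤ (diagSubalgebra H D).toSubmodule) := by
  have base : ∀ α ∈ b.support, ∃ m : ℕ, α.1 c = m ∧ (m = 0 →
      (rootSpace H (α.1 : H → ℂ)).toSubmodule ≤ (diagSubalgebra H D).toSubmodule ∧
      (rootSpace H (-(α.1 : H → ℂ))).toSubmodule ≤ (diagSubalgebra H D).toSubmodule) := by
    intro α hα
    by_cases h : α ∈ D
    · exact ⟨0, by rw [(hc α hα).1 h, Nat.cast_zero], fun _ =>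
        ⟨rootSpace_le_diagSubalgebra h, rootSpace_neg_le_diagSubalgebra h⟩⟩
    · exact ⟨1, by rw [(hc α hα).2 h, Nat.cast_one], fun h => absurd h one_ne_zero⟩
  -- A positive root is built by adding simple roots one at a time through roots, and `m` counts
  -- those added off `D`. If the total is zero, both summands have value zero, and
  -- `rootSpace_add_le` applies to the roots and to their negatives.
  refine hα.induction_on_add base fun i j k hk ⟨m, hm, hm'⟩ hj => ?_
  obtain ⟨m', hm₁, hm₂⟩ := base j hj
  have hk' : (k.1 : H → ℂ) = j.1 + i.1 := by
    rw [add_comm]; exact congrArg (fun f : Module.Dual ℂ H => (f : H → ℂ)) hk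
  refine ⟨m' + m, by rw [hk', Pi.add_apply, hm, hm₁, Nat.cast_add], fun h => ?_⟩
  obtain ⟨h₁, h₂⟩ := hm₂ (by omega)
  obtain ⟨h₃, h₄⟩ := hm' (by omega)
  refine ⟨rootSpace_add_le (H.isNonZero_coe_root j) (H.isNonZero_coe_root k) hk' h₁ h₃, ?_⟩
  rw [← Weight.coe_neg] at h₂ h₄ ⊢
  refine rootSpace_add_le (H.isNonZero_coe_root j).neg (H.isNonZero_coe_root k).neg ?_ h₂ h₄
  rw [Weight.coe_neg, Weight.coe_neg, Weight.coe_neg, hk', neg_add]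

/-- Every root has an integral value at `c`, and by `pos_root_apply` the value zero forces the root
space into `g_D`. So positive roots not in `g_D` have positive value, and negative roots either lie
in `g_D` or have negative value. -/
theorem isTriangular_levi {c : H}
    (hc : ∀ α ∈ b.support, (α ∈ D → α.1 c = 0) ∧ (α ∉ D → α.1 c = 1)) (hD : D ⊆ b.support) :
    IsTriangular (c : g) (levi H D) (nilPlus H b D) where
  lie_eq_zero := lie_levi_eq_zero fun α hα => (hc α (hD hα)).1 hα
  le_eig := by
    refine iSup_le ?_
    rintro ⟨α, hα, hα'⟩ e he
    obtain ⟨m, hm, hm'⟩ := pos_root_apply hc hα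
    refine mem_eig (μ := m) ?_ (by rw [LieAlgebra.ad_apply, lie_rootSpace he, hm])
    have : m ≠ 0 := fun h => hα' (hm' h).1
    simpa using Nat.pos_of_ne_zero this
  sup_eq_top := by
    have := congrArg LieSubmodule.toSubmodule (cartan_sup_iSup_rootSpace_eq_top H)
    rw [LieSubmodule.sup_toSubmodule, LieSubmodule.iSup_toSubmodule,
      LieSubmodule.top_toSubmodule] at this
    rw [eq_top_iff, ← this]
    refine sup_le ?_ (iSup_le fun α => ?_)
    · exact le_sup_of_le_right (le_sup_of_le_left fun x hx => le_levi hx)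
    · rw [LieSubmodule.iSup_toSubmodule]
      refine iSup_le fun hα => ?_
      let α' : H.root := ⟨α, by simpa using hα⟩
      let := (rootSystem H).indexNeg
      rcases RootPairing.Base.IsPos.or_neg b α' with h | h
      · by_cases h' : (rootSpace H (α : H → ℂ)).toSubmodule ≤ (diagSubalgebra H D).toSubmodule
        · exact le_sup_of_le_right (le_sup_of_le_left (h'.trans diagSubalgebra_le_levi))
        · exact le_sup_of_le_right (le_sup_of_le_right
            (le_iSup (fun α : {α : H.root // b.IsPos α ∧ ¬ (rootSpace H (α.1 : H → ℂ)).toSubmodule ≤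
              (diagSubalgebra H D).toSubmodule} => (rootSpace H (α.1.1 : H → ℂ)).toSubmodule)
              ⟨α', h, h'⟩))
      · have hneg : (((-α' : H.root).1 : Weight ℂ H g) : H → ℂ) = -(α : H → ℂ) := by
          have : (rootSystem H).root (-α') = -(rootSystem H).root α' := by
            rw [RootPairing.indexNeg_neg, RootPairing.root_reflectionPerm,
              RootPairing.reflection_apply_self]
          exact congrArg (fun f : Module.Dual ℂ H => (f : H → ℂ)) this
        obtain ⟨m, hm, hm'⟩ := pos_root_apply hc h
        rw [hneg] at hm hm'
        by_cases hm₀ : m = 0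
        · have := (hm' hm₀).2
          rw [neg_neg] at this
          exact le_sup_of_le_right (le_sup_of_le_left (this.trans diagSubalgebra_le_levi))
        · refine le_sup_of_le_left fun e he => mem_eig (μ := -m) ?_ ?_
          · simpa using Nat.pos_of_ne_zero hm₀
          · rw [LieAlgebra.ad_apply, lie_rootSpace he, ← hm, Pi.neg_apply, neg_neg]

theorem coroot_mem_diagSubalgebra {α : H.root} (hα : α ∈ D) :
    (coroot α.1 : g) ∈ diagSubalgebra H D := by
  obtain ⟨t, e, f, ht, he, hf⟩ := exists_isSl2Triple_of_weight_isNonZero (H.isNonZero_coe_root α)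
  rw [← ht.h_eq_coroot (H.isNonZero_coe_root α) he hf, ← ht.lie_e_f]
  exact (diagSubalgebra H D).lie_mem (rootSpace_le_diagSubalgebra hα he)
    (rootSpace_neg_le_diagSubalgebra hα hf)

/-- `g_D` meets the centre of `l_D` trivially. -/
theorem eq_zero_of_mem_leviCentre {z : g} (hz : z ∈ diagSubalgebra H D)
    (hz' : z ∈ leviCentre H D) : z = 0 := by
  obtain ⟨hzl, hzc⟩ := mem_leviCentre.1 hz'
  -- `z` commutes with `h`, and a Cartan subalgebra is its own normaliser.
  have hzH : z ∈ H := by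
    rw [← LieSubalgebra.IsCartanSubalgebra.self_normalizing (H := H),
      LieSubalgebra.mem_normalizer_iff]
    intro y hy
    rw [hzc y (le_levi hy)]
    exact H.zero_mem
  have hstable : ∀ (r : ℂ), ∀ x ∈ diagSubalgebra H D, ∀ w ∈ (LieAlgebra.ad ℂ g z).eigenspace r,
      LieAlgebra.ad ℂ g x w ∈ (LieAlgebra.ad ℂ g z).eigenspace r := by
    intro r x hx w hw
    rw [Module.End.mem_eigenspace_iff, LieAlgebra.ad_apply] at *
    rw [LieAlgebra.ad_apply, leibniz_lie, hzc x (diagSubalgebra_le_levi hx), zero_lie, zero_add,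
      hw, lie_smul]
  -- `g_D` acts on each eigenspace of `ad z`, and with trace zero: brackets have trace zero, and
  -- each generating root vector is a multiple of its bracket with a coroot, where the root takes
  -- the value `±2`.
  have htrace : ∀ (r : ℂ) (x : g) (hx : x ∈ diagSubalgebra H D),
      LinearMap.trace ℂ _ ((LieAlgebra.ad ℂ g x).restrict (hstable r x hx)) = 0 := by
    intro r
    let ρ : diagSubalgebra H D →ₗ[ℂ] Module.End ℂ ((LieAlgebra.ad ℂ g z).eigenspace r) :=
      { toFun x := (LieAlgebra.ad ℂ g x.1).restrict (hstable r x.1 x.2)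
        map_add' x y := LinearMap.ext fun w => Subtype.ext (add_lie x.1 y.1 w.1)
        map_smul' t x := LinearMap.ext fun w => Subtype.ext (smul_lie t x.1 w.1) }
    have hρ : ∀ x y, LinearMap.trace ℂ _ (ρ ⁅x, y⁆) = 0 := fun x y => by
      rw [show ρ ⁅x, y⁆ = ⁅ρ x, ρ y⁆ from
        LinearMap.ext fun w => Subtype.ext (lie_lie x.1 y.1 w.1), LinearMap.trace_lie]
    have hgen : ∀ x (t : ℂ), t ≠ 0 → (∃ y : diagSubalgebra H D, ⁅y, x⁆ = t • x) → LinearMap.trace ℂ _ (ρ x) = 0 := by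
      rintro x t ht ⟨y, hy⟩
      have := hρ y x
      rw [hy, map_smul, map_smul, smul_eq_mul, mul_eq_zero] at this
      exact this.resolve_left ht
    intro x hx
    change LinearMap.trace ℂ _ (ρ ⟨x, hx⟩) = 0
    induction hx using LieSubalgebra.lieSpan_induction with
    | mem x hx =>
      obtain ⟨α, hα, he | he⟩ := hx
      · refine hgen _ 2 two_ne_zero ⟨⟨_, coroot_mem_diagSubalgebra hα⟩, Subtype.ext ?_⟩
        exact (lie_rootSpace he _).trans (by rw [root_apply_coroot (H.isNonZero_coe_root α)]; rfl)
      · refine hgen _ (-2) (neg_ne_zero.2 two_ne_zero)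
          ⟨⟨_, coroot_mem_diagSubalgebra hα⟩, Subtype.ext ?_⟩
        exact (lie_rootSpace he _).trans
          (by rw [Pi.neg_apply, root_apply_coroot (H.isNonZero_coe_root α)]; rfl)
    | zero => exact (congrArg (LinearMap.trace ℂ _) (map_zero ρ)).trans (map_zero _)
    | add x y hx hy h h' =>
      rw [show (⟨x + y, _⟩ : diagSubalgebra H D) = ⟨x, hx⟩ + ⟨y, hy⟩ from rfl, map_add, map_add,
        h, h', add_zero]
    | smul t x hx h =>
      rw [show (⟨t • x, _⟩ : diagSubalgebra H D) = t • ⟨x, hx⟩ from rfl, map_smul, map_smul, h,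
        smul_zero]
    | lie x y hx hy _ _ => exact hρ ⟨x, hx⟩ ⟨y, hy⟩
  -- On the eigenspace for `r = α(z)`, `ad z` is the scalar `r`, with trace `r` times the dimension.
  -- This eigenspace contains a nonzero weight vector, so trace zero forces `r = 0`.
  have hker : ∀ α : Weight ℂ H g, α ⟨z, hzH⟩ = 0 := by
    intro α
    by_contra hα
    have h := htrace (α ⟨z, hzH⟩) z hz
    have h₁ : (LieAlgebra.ad ℂ g z).restrict (hstable (α ⟨z, hzH⟩) z hz) =
        α ⟨z, hzH⟩ • LinearMap.id := by
      ext ⟨w, hw⟩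
      exact Module.End.mem_eigenspace_iff.1 hw
    rw [h₁, map_smul, LinearMap.trace_id, smul_eq_mul, mul_eq_zero] at h
    have h₂ := h.resolve_left hα
    rw [Nat.cast_eq_zero, Submodule.finrank_eq_zero] at h₂
    obtain ⟨x, hx, hx₀⟩ := α.exists_ne_zero
    refine hx₀ ((Submodule.mem_bot ℂ).1 (h₂ ▸ Module.End.mem_eigenspace_iff.2 ?_))
    exact lie_rootSpace hx ⟨z, hzH⟩
  have : (⟨z, hzH⟩ : H) ∈ (⨅ α : Weight ℂ H g, α.ker : Submodule ℂ H) := by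
    rw [Submodule.mem_iInf]
    exact hker
  rw [iInf_ker_weight_eq_bot, Submodule.mem_bot] at this
  exact congrArg Subtype.val this

/-- Every element of `h` is the sum of an element of `g_D` and an element of the centre of `l_D`. -/
theorem exists_cartan_decomposition (hD : D ⊆ b.support) (x : H) :
    ∃ y ∈ diagSubalgebra H D, (x : g) - y ∈ leviCentre H D := by
  let s : (D → ℂ) →ₗ[ℂ] H := Fintype.linearCombination ℂ fun α : D => (rootSystem H).coroot α.1
  have hs : ∀ v, (s v : g) ∈ diagSubalgebra H D := by
    intro v
    simp only [s, Fintype.linearCombination_apply, AddSubmonoidClass.coe_finsetSum]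
    exact sum_mem fun α _ => (diagSubalgebra H D).toSubmodule.smul_mem _
      (coroot_mem_diagSubalgebra α.2)
  let ev : H →ₗ[ℂ] (D → ℂ) := LinearMap.pi fun α : D => Weight.toLinear ℂ H g α.1.1
  have hev : ∀ y : H, ev y = 0 → (y : g) ∈ leviCentre H D := fun y hy =>
    mem_leviCentre.2 ⟨le_levi y.2, lie_levi_eq_zero fun α hα => congrFun hy ⟨α, hα⟩⟩
  -- If the roots in `D` vanish on a combination of their coroots, that combination lies in `g_D ∩
  -- c_D = 0`, and simple coroots are independent. An injective endomorphism of `D → ℂ` is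
  -- surjective, so coroots of `D` can match all the values `α(x)`, `α ∈ D`.
  have hinj : Function.Injective (ev ∘ₗ s) := by
    rw [← LinearMap.ker_eq_bot, LinearMap.ker_eq_bot']
    intro v hv
    have h₀ : s v = 0 := Subtype.ext (eq_zero_of_mem_leviCentre (hs v) (hev _ hv))
    have hli : LinearIndependent ℂ fun α : (D : Set H.root) => (rootSystem H).coroot α.1 :=
      b.linearIndepOn_coroot.mono (Finset.coe_subset.2 hD)
    exact funext (Fintype.linearIndependent_iff.1 hli v h₀)
  obtain ⟨v, hv⟩ := LinearMap.injective_iff_surjective.1 hinj (ev x)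
  refine ⟨s v, hs v, hev (x - s v) ?_⟩
  rw [map_sub, sub_eq_zero]
  exact hv.symm

theorem lie_mem_diagSubalgebra {x y : g} (hx : x ∈ H) (hy : y ∈ diagSubalgebra H D) :
    ⁅x, y⁆ ∈ diagSubalgebra H D := by
  induction hy using LieSubalgebra.lieSpan_induction with
  | mem y hy =>
    obtain ⟨α, hα, he | he⟩ := hy
    · rw [lie_rootSpace he ⟨x, hx⟩]
      exact (diagSubalgebra H D).smul_mem _ (rootSpace_le_diagSubalgebra hα he)
    · rw [lie_rootSpace he ⟨x, hx⟩]
      exact (diagSubalgebra H D).smul_mem _ (rootSpace_neg_le_diagSubalgebra hα he)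
  | zero => rw [lie_zero]; exact (diagSubalgebra H D).zero_mem
  | add y y' _ _ h h' => rw [lie_add]; exact (diagSubalgebra H D).add_mem h h'
  | smul r y _ h => rw [lie_smul]; exact (diagSubalgebra H D).smul_mem r h
  | lie y y' hy hy' h h' =>
    rw [leibniz_lie]
    exact (diagSubalgebra H D).add_mem ((diagSubalgebra H D).lie_mem h hy')
      ((diagSubalgebra H D).lie_mem hy h')

variable (H D) in
theorem levi_toSubmodule :
    (levi H D).toSubmodule = (diagSubalgebra H D).toSubmodule ⊔ H.toSubmodule := by
  refine le_antisymm ?_ (sup_le diagSubalgebra_le_levi le_levi)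
  let K : LieSubalgebra ℂ g :=
    { (diagSubalgebra H D).toSubmodule ⊔ H.toSubmodule with
      lie_mem' := fun {x y} hx hy => by
        obtain ⟨u, hu, v, hv, rfl⟩ := Submodule.mem_sup.1 hx
        obtain ⟨u', hu', v', hv', rfl⟩ := Submodule.mem_sup.1 hy
        rw [add_lie, lie_add, lie_add, ← add_assoc]
        refine Submodule.add_mem_sup (add_mem (add_mem ?_ ?_) ?_) (H.lie_mem hv hv')
        · exact (diagSubalgebra H D).lie_mem hu hu'
        · rw [← lie_skew]
          exact neg_mem (lie_mem_diagSubalgebra hv' hu)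
        · exact lie_mem_diagSubalgebra hv hu' }
  exact (sup_le (fun x hx => Submodule.mem_sup_left hx) fun x hx => Submodule.mem_sup_right hx :
    levi H D ≤ K)

theorem exists_levi_decomposition (hD : D ⊆ b.support) (z : levi H D) :
    ∃ y : diagSubalgebra H D, (z : g) - y ∈ leviCentre H D := by
  have hz : (z : g) ∈ (levi H D).toSubmodule := z.2
  rw [levi_toSubmodule] at hz
  obtain ⟨u, hu, v, hv, h⟩ := Submodule.mem_sup.1 hz
  obtain ⟨y, hy, hy'⟩ := exists_cartan_decomposition hD ⟨v, hv⟩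
  refine ⟨⟨u + y, add_mem hu hy⟩, ?_⟩
  rwa [← h, add_sub_add_left_eq_sub]

/-- Since `g_D ∩ c_D = 0`, the chosen component in `g_D` is determined modulo the centre. Linearity
and compatibility with brackets therefore need only be checked modulo the centre. -/
theorem existsUnique_isLeviProj (hD : D ⊆ b.support) :
    ∃! p : levi H D →ₗ⁅ℂ⁆ diagSubalgebra H D, IsLeviProj H D p := by
  choose q hq using exists_levi_decomposition (H := H) hD
  have hadd : ∀ {c d : g}, c ∈ leviCentre H D → d ∈ leviCentre H D → c + d ∈ leviCentre H D := by
    intro c d hc hd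
    rw [mem_leviCentre] at *
    exact ⟨add_mem hc.1 hd.1, fun z hz => by rw [add_lie, hc.2 z hz, hd.2 z hz, add_zero]⟩
  have hsmul : ∀ (r : ℂ) {c : g}, c ∈ leviCentre H D → r • c ∈ leviCentre H D := by
    intro r c hc
    rw [mem_leviCentre] at *
    exact ⟨(levi H D).smul_mem r hc.1, fun z hz => by rw [smul_lie, hc.2 z hz, smul_zero]⟩
  have huniq : ∀ (z : levi H D) (y : diagSubalgebra H D), (z : g) - y ∈ leviCentre H D →
      q z = y := by
    intro z y hy
    refine Subtype.ext (sub_eq_zero.1 (eq_zero_of_mem_leviCentre (H := H) (D := D)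
      (sub_mem (q z).2 y.2) ?_))
    have := hadd hy (hsmul (-1) (hq z))
    rwa [show ((z : g) - y) + (-1 : ℂ) • ((z : g) - q z) = q z - y by module] at this
  let p : levi H D →ₗ⁅ℂ⁆ diagSubalgebra H D :=
    { toFun := q
      map_add' := fun z z' => huniq _ _ (by
        have := hadd (hq z) (hq z')
        rwa [show ((z : g) - q z) + ((z' : g) - q z') = (z + z' : g) - (q z + q z') by abel] at this)
      map_smul' := fun r z => huniq _ _ (by
        have := hsmul r (hq z)
        rwa [smul_sub] at this)
      -- Central parts drop out of brackets, so `[z, z'] = [q z, q z']` exactly.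
      map_lie' := fun {z z'} => huniq _ _ (by
        have h₁ := (mem_leviCentre.1 (hq z)).2 z' z'.2
        have h₂ := (mem_leviCentre.1 (hq z')).2 (q z) (diagSubalgebra_le_levi (q z).2)
        rw [sub_lie, sub_eq_zero] at h₁ h₂
        rw [LieSubalgebra.coe_bracket, LieSubalgebra.coe_bracket, h₁, ← lie_skew, h₂, lie_skew,
          sub_self, mem_leviCentre]
        exact ⟨zero_mem _, fun z _ => zero_lie z⟩) }
  have hp : ∀ z : levi H D, (z : g) - p z ∈ leviCentre H D := hq
  refine ⟨p, ⟨fun y => huniq _ _ ?_, fun c hc => huniq _ _ ?_⟩, fun p' hp' => ?_⟩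
  · rw [sub_self, mem_leviCentre]
    exact ⟨zero_mem _, fun z _ => zero_lie z⟩
  · rw [ZeroMemClass.coe_zero, sub_zero]
    exact ⟨c.2, hc⟩
  · refine LieHom.ext fun z => ?_
    obtain ⟨hc, hc'⟩ := hp z
    have := hp'.2 _ hc'
    have h₁ : (⟨(z : g) - p z, hc⟩ : levi H D) =
      z - ⟨p z, diagSubalgebra_le_levi (p z).2⟩ := rfl
    rw [h₁, map_sub, hp'.1, sub_eq_zero] at this
    exact this

end Levi

/-! ### The Harish-Chandra maps and their compatibilities -/

section HarishChandra

open LieAlgebra LieModule IsKilling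

variable {g : Type*} [LieRing g] [LieAlgebra ℂ g] [FiniteDimensional ℂ g]
variable {H : LieSubalgebra ℂ g} [H.IsCartanSubalgebra] {D : Finset H.root}

theorem leviIncl_mem_invariants {k : ℕ} (z : TPow k (U (levi H D))) :
    leviIncl H D k z ∈ invariants k (leviCentre H D) :=
  mem_invariants.2 fun _ hd =>
    sub_eq_zero.1 (innerDer_tpowMap_eq_zero (mem_leviCentre.1 hd).2 z)

variable [IsSemisimple ℂ g] {b : (rootSystem H).Base}

theorem mem_hcIdeal {k : ℕ} {x : TPow k (U g)} : x ∈ hcIdeal H b D k ↔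
    x ∈ invariants k (leviCentre H D) ∧ x ∈ slotIdeal (nilPlus H b D) k := Iff.rfl

/-- Invariance under the single central element `c` already yields the component. The difference is
then invariant under all of `c_D`, because `(U l_D)^{⊗ k}` is. -/
theorem existsUnique_isHCProj (hD : D ⊆ b.support) {k : ℕ} (x : invariants k (leviCentre H D)) :
    ∃! z, IsHCProj H b D x z := by
  obtain ⟨c, hc⟩ := exists_grading_element D b
  have ht := isTriangular_levi hc hD
  have hcD : (c : g) ∈ leviCentre H D :=
    mem_leviCentre.2 ⟨le_levi c.2, lie_levi_eq_zero fun α hα => (hc α (hD hα)).1 hα⟩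
  obtain ⟨z, hz⟩ := ht.exists_sub_mem_slotIdeal (x := (x : TPow k (U g)))
    (sub_eq_zero.2 (mem_invariants.1 x.2 _ hcD))
  refine ⟨z, mem_hcIdeal.2 ⟨sub_mem x.2 (leviIncl_mem_invariants z), hz⟩, fun z' hz' => ?_⟩
  refine sub_eq_zero.1 (ht.tpowMap_mem_slotIdeal (k := k) ?_)
  have := sub_mem hz (mem_hcIdeal.1 hz').2
  rw [sub_sub_sub_cancel_left] at this
  rwa [map_sub]

theorem isHCProj_hcMap (hD : D ⊆ b.support) {k : ℕ} (x : invariants k (leviCentre H D)) :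
    IsHCProj H b D x (hcMap H b D k x) :=
  Classical.epsilon_spec (existsUnique_isHCProj hD x).exists

theorem hcMap_eq (hD : D ⊆ b.support) {k : ℕ} {x : invariants k (leviCentre H D)}
    {z : TPow k (U (levi H D))} (hz : IsHCProj H b D x z) : z = hcMap H b D k x :=
  (existsUnique_isHCProj hD x).unique hz (isHCProj_hcMap hD x)

/-- By uniqueness it suffices that the face of `x - π(x)` lies in `I_{k+1}`; naturality identifies
the face of the included `π(x)` with the inclusion of its face. The insertions and the Hochschild
differential are treated the same way. -/
theorem faceMap_hcMap (hD : D ⊆ b.support) {k : ℕ} (i : Fin k)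
    (x : invariants k (leviCentre H D)) :
    faceMap (comul (levi H D)) i (hcMap H b D k x) =
      hcMap H b D (k + 1) ⟨faceMap (comul g) i x.1, faceMap_mem_invariants i x.2⟩ := by
  refine hcMap_eq hD ?_
  obtain ⟨h₁, h₂⟩ := mem_hcIdeal.1 (isHCProj_hcMap hD x)
  have h : faceMap (comul g) i (x.1 - leviIncl H D k (hcMap H b D k x)) =
      faceMap (comul g) i x.1 -
        leviIncl H D (k + 1) (faceMap (comul (levi H D)) i (hcMap H b D k x)) := by
    rw [map_sub, leviIncl, leviIncl, faceMap_tpowMap _ _ _ (comul_uMap _)]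
  exact mem_hcIdeal.2 ⟨h ▸ faceMap_mem_invariants i h₁, h ▸ faceMap_mem_slotIdeal i h₂⟩

theorem insertOnes_hcMap (hD : D ⊆ b.support) {k l : ℕ} (i : ℕ) (hi : i + l ≤ k)
    (x : invariants l (leviCentre H D)) :
    insertOnes i hi (hcMap H b D l x) =
      hcMap H b D k ⟨insertOnes i hi x.1, insertOnes_mem_invariants i hi x.2⟩ := by
  refine hcMap_eq hD ?_
  obtain ⟨h₁, h₂⟩ := mem_hcIdeal.1 (isHCProj_hcMap hD x)
  have h : insertOnes i hi (x.1 - leviIncl H D l (hcMap H b D l x)) =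
      insertOnes i hi x.1 - leviIncl H D k (insertOnes i hi (hcMap H b D l x)) := by
    rw [map_sub, leviIncl, leviIncl, insertOnes_tpowMap]
  exact mem_hcIdeal.2 ⟨h ▸ insertOnes_mem_invariants i hi h₁, h ▸ insertOnes_mem_slotIdeal i hi h₂⟩

theorem hochschild_hcMap (hD : D ⊆ b.support) (k : ℕ) (x : invariants k (leviCentre H D)) :
    hochschild (comul (levi H D)) k (hcMap H b D k x) =
      hcMap H b D (k + 1) ⟨hochschild (comul g) k x.1, hochschild_mem_invariants x.2⟩ := by
  refine hcMap_eq hD ?_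
  obtain ⟨h₁, h₂⟩ := mem_hcIdeal.1 (isHCProj_hcMap hD x)
  have h : hochschild (comul g) k (x.1 - leviIncl H D k (hcMap H b D k x)) =
      hochschild (comul g) k x.1 -
        leviIncl H D (k + 1) (hochschild (comul (levi H D)) k (hcMap H b D k x)) := by
    rw [map_sub, leviIncl, leviIncl, hochschild_tpowMap _ _ _ (comul_uMap _)]
  exact mem_hcIdeal.2 ⟨h ▸ hochschild_mem_invariants h₁, h ▸ hochschild_mem_slotIdeal h₂⟩

end HarishChandra

end HC
end

theorem mainTheorem7 {g : Type*} [LieRing g] [LieAlgebra ℂ g] [FiniteDimensional ℂ g]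
    [LieAlgebra.IsSemisimple ℂ g] (H : LieSubalgebra ℂ g) [H.IsCartanSubalgebra]
    (b : (LieAlgebra.IsKilling.rootSystem H).Base) (D : Finset H.root) (hD : D ⊆ b.support) :
    -- the maps are well defined
    (∃! p : HC.levi H D →ₗ⁅ℂ⁆ HC.diagSubalgebra H D, HC.IsLeviProj H D p) ∧
    (∀ (k : ℕ) (x : HC.invariants k (HC.leviCentre H D)), ∃! z, HC.IsHCProj H b D x z) ∧
    -- compatibility with the coproduct face maps
    (∀ (k : ℕ) (i : Fin k) (x : HC.invariants k (HC.leviCentre H D)),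
      ∃ h : HC.faceMap (HC.comul g) i x.1 ∈ HC.invariants (k + 1) (HC.leviCentre H D),
        HC.faceMap (HC.comul (HC.levi H D)) i (HC.hcMap H b D k x) =
          HC.hcMap H b D (k + 1) ⟨HC.faceMap (HC.comul g) i x.1, h⟩ ∧
        HC.faceMap (HC.comul (HC.diagSubalgebra H D)) i (HC.hcMapBar H b D k x) =
          HC.hcMapBar H b D (k + 1) ⟨HC.faceMap (HC.comul g) i x.1, h⟩) ∧
    -- compatibility with the insertions
    (∀ (k l i : ℕ) (hi : i + l ≤ k) (y : HC.invariants l (HC.leviCentre H D)),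
      ∃ h : HC.insertOnes i hi y.1 ∈ HC.invariants k (HC.leviCentre H D),
        HC.insertOnes i hi (HC.hcMap H b D l y) =
          HC.hcMap H b D k ⟨HC.insertOnes i hi y.1, h⟩ ∧
        HC.insertOnes i hi (HC.hcMapBar H b D l y) =
          HC.hcMapBar H b D k ⟨HC.insertOnes i hi y.1, h⟩) ∧
    -- compatibility with the Hochschild differential
    (∀ (k : ℕ) (x : HC.invariants k (HC.leviCentre H D)),
      ∃ h : HC.hochschild (HC.comul g) k x.1 ∈ HC.invariants (k + 1) (HC.leviCentre H D),
        HC.hochschild (HC.comul (HC.levi H D)) k (HC.hcMap H b D k x) =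
          HC.hcMap H b D (k + 1) ⟨HC.hochschild (HC.comul g) k x.1, h⟩ ∧
        HC.hochschild (HC.comul (HC.diagSubalgebra H D)) k (HC.hcMapBar H b D k x) =
          HC.hcMapBar H b D (k + 1) ⟨HC.hochschild (HC.comul g) k x.1, h⟩) := by
  refine ⟨HC.existsUnique_isLeviProj hD, fun k x => HC.existsUnique_isHCProj hD x,
    fun k i x => ⟨HC.faceMap_mem_invariants i x.2, HC.faceMap_hcMap hD i x, ?_⟩,
    fun k l i hi y => ⟨HC.insertOnes_mem_invariants i hi y.2, HC.insertOnes_hcMap hD i hi y, ?_⟩,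
    fun k x => ⟨HC.hochschild_mem_invariants x.2, HC.hochschild_hcMap hD k x, ?_⟩⟩
  · rw [HC.hcMapBar, HC.hcMapBar, HC.faceMap_tpowMap _ _ _ (HC.comul_uMap _),
      HC.faceMap_hcMap hD]
  · rw [HC.hcMapBar, HC.hcMapBar, HC.insertOnes_tpowMap, HC.insertOnes_hcMap hD]
  · rw [HC.hcMapBar, HC.hcMapBar, HC.hochschild_tpowMap _ _ _ (HC.comul_uMap _),
      HC.hochschild_hcMap hD]
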